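/- Let $G$ be a profinite group. For a topological group $Q$ acting on a space $X$, a $Q$-sheaf of $\mathbb{Q}$-modules over $X$ is a $Q$-equivariant local homeomorphism $E\to X$ of spaces with continuous $Q$-actions, whose stalks $E_x$ are $\mathbb{Q}$-modules such that fibrewise subtraction $E\times_X E\to E$ and each scalar multiplication $E\to E$ are continuous and each $q\colon E_x\to E_{qx}$ is linear; maps are continuous equivariant maps over $X$ that are linear on stalks. Let $\mathcal{S}G$ be the set of closed subgroups of $G$, with $G$ acting by conjugation and with the topology generated by the sets $\{L : NL=NK\}$ for $N$ open normal in $G$ and $K\in\mathcal{S}G$. A *Weyl-$G$-sheaf* is a $G$-sheaf $E$ of $\mathbb{Q}$-modules over $\mathcal{S}G$ such that $K$ acts trivially on $E_K$ for every $K$; these form a full subcategory of the $G$-sheaves over $\mathcal SG$. The same definitions apply to the finite discrete groups $G/N$, for which $\mathcal{S}(G/N)$ is a finite discrete space. Let $p_N\colon\mathcal{S}G\to\mathcal{S}(G/N)$, $K\mapsto KN/N$, and, for open normal subgroups $M\leqslant N$, let $\phi_{M,N}\colon\mathcal{S}(G/M)\to\mathcal{S}(G/N)$ be the maps induced by the projections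 of groups. Let $p\colon X\to Y$ be one of these maps, over the surjection of groups $A\to B$ with kernel $C$. The pullback $\bar p^*D$ of a $B$-sheaf $D$ over $Y$ is the sheaf $X\times_Y D$ over $X$, with $A$ acting on $D$ through $B$. The pushforward $\bar p_*E$ of an $A$-sheaf $E$ over $X$ is the $B$-sheaf $V\mapsto E(p^{-1}V)^{C}$ over $Y$. The adjoint of a map $f\colon\bar p^*D\to E$ is the map $D\to\bar p_*E$ that sends $a\in D_y$ to the section $x\mapsto f_x(a)$ of $E$ over $p^{-1}\{y\}$. A *$G_\bullet$-sheaf of $\mathbb{Q}$-modules over $\mathcal{S}G_\bullet$* consists of a $G/N$-sheaf $D_N$ of $\mathbb{Q}$-modules over $\mathcal{S}(G/N)$ for each open normal subgroup $N$ of $G$ and maps $\alpha_{M,N}\colon\bar\phi_{M,N}^*D_N\to D_M$ of $G/M$-sheaves for all open normal $M\leqslant N$, functorial in the sense that $\alpha_{N,N}=\mathrm{id}$ and $\alpha_{L,N}=\alpha_{L,M}\circ\bar\phi_{L,M}^*\alpha_{M,N}$ for $L\leqslant M\leqslant N$. Maps are families of maps $D_N\to D'_N$ of $G/N$-sheaves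 that commute with the $\alpha_{M,N}$. Let $\operatorname{colim}\,\mathrm{Weyl}(G_\bullet)$ be the full subcategory of those $D_\bullet$ such that every $D_N$ is a Weyl-$G/N$-sheaf and every adjoint structure map $\bar\alpha_{M,N}\colon D_N\to(\bar\phi_{M,N})_*D_M$, $M\leqslant N$, is an isomorphism. Each $G$-sheaf $E$ over $\mathcal{S}G$ gives a $G_\bullet$-sheaf $\bar p_\bullet E=\{(\bar p_N)_*E\}_N$, whose structure maps are the restriction maps of sections (the adjoints of the identifications $(\bar p_N)_*E=(\bar\phi_{M,N})_*(\bar p_M)_*E$). Each $G_\bullet$-sheaf $D_\bullet$ gives a diagram $N\mapsto\bar p_N^*D_N$ of $G$-sheaves over $\mathcal{S}G$, indexed by the open normal subgroups under reverse inclusion, whose transition maps are induced by the $\alpha_{M,N}$. Then the category of $G$-sheaves of $\mathbb{Q}$-modules over $\mathcal{S}G$ has all colimits of this shape, and the functors $D_\bullet\mapsto\operatorname{colim}_N\bar p_N^*D_N$ and $E\mapsto\bar p_\bullet E$ restrict to mutually inverse equivalences of categories $$\operatorname{colim}\,\mathrm{Weyl}(G_\bullet)\;\simeq\;\{\text{Weyl-}G\text{-sheaves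 of }\mathbb{Q}\text{-modules over }\mathcal{S}G\}.$$ -/

import Mathlib

open CategoryTheory Topology

universe u w

/-- The disjoint union of a family of stalks `S x`, `x : X` (the underlying set of a sheaf space). -/
@[ext]
structure Etale {X : Type u} (S : X → Type u) : Type u where
  base : X
  val : S base

/-- A `G`-equivariant sheaf of `R`-modules over a `G`-space `X`, as a sheaf space: an equivariant
local homeomorphism `E → X` of spaces with continuous `G`-actions, whose fibres (the stalks) are
`R`-modules with fibrewise subtraction `E ×_X E → E` and scalar multiplications `E → E` continuous,
and such that every `g : E_x → E_{gx}` is `R`-linear. The action is recorded as the family of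
linear maps `act g : E_x → E_y` for `g • x = y`. -/
structure EqSheaf (G X : Type u) [Group G] [TopologicalSpace G] [TopologicalSpace X]
    [MulAction G X] (R : Type w) [Ring R] where
  stalk : X → Type u
  [addCommGroup : ∀ x, AddCommGroup (stalk x)]
  [module : ∀ x, Module R (stalk x)]
  [topology : TopologicalSpace (Etale stalk)]
  isLocalHomeomorph : IsLocalHomeomorph (Etale.base : Etale stalk → X)
  /-- Continuity of `(e, e') ↦ e - e'` on the fibre product, with its subspace topology. -/
  continuous_sub : @Continuous (Etale fun x => stalk x × stalk x) (Etale stalk)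
    (TopologicalSpace.induced
      (fun q => ((⟨q.base, q.val.1⟩, ⟨q.base, q.val.2⟩) : Etale stalk × Etale stalk))
      inferInstance) topology
    (fun q => ⟨q.base, q.val.1 - q.val.2⟩)
  continuous_smul : ∀ r : R, Continuous fun e : Etale stalk => (⟨e.base, r • e.val⟩ : Etale stalk)
  act : ∀ (g : G) {x y : X}, g • x = y → (stalk x →ₗ[R] stalk y)
  act_one : ∀ (x : X) (a : stalk x), act 1 (one_smul G x) a = a
  act_mul : ∀ (g h : G) {x y z : X} (hxy : h • x = y) (hyz : g • y = z) (hxz : (g * h) • x = z)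
    (a : stalk x), act (g * h) hxz a = act g hyz (act h hxy a)
  continuous_act : Continuous fun q : G × Etale stalk =>
    (⟨q.1 • q.2.base, act q.1 rfl q.2.val⟩ : Etale stalk)

namespace EqSheaf

attribute [instance] EqSheaf.addCommGroup EqSheaf.module EqSheaf.topology

section

variable {G X : Type u} [Group G] [TopologicalSpace G] [TopologicalSpace X] [MulAction G X]
  {R : Type w} [Ring R]

/-- A map of `G`-sheaves of `R`-modules: a continuous equivariant map over `X`, linear on stalks. -/
@[ext]
structure Hom (E F : EqSheaf G X R) where
  app : ∀ x, E.stalk x →ₗ[R] F.stalk x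
  continuous_map : Continuous fun e : Etale E.stalk => (⟨e.base, app e.base e.val⟩ : Etale F.stalk)
  equivariant : ∀ (g : G) {x y : X} (h : g • x = y) (a : E.stalk x),
    app y (E.act g h a) = F.act g h (app x a)

instance : Category (EqSheaf G X R) where
  Hom := Hom
  id E := ⟨fun _ => LinearMap.id, continuous_id, fun _ _ _ _ _ => rfl⟩
  comp f g := ⟨fun x => (g.app x).comp (f.app x), g.continuous_map.comp f.continuous_map,
    fun k _ _ h a => by simp [f.equivariant, g.equivariant]⟩

@[ext]
theorem hom_ext {E F : EqSheaf G X R} {f g : E ⟶ F} (h : ∀ x a, f.app x a = g.app x a) : f = g :=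
  Hom.ext (funext fun x => LinearMap.ext (h x))

@[simp]
theorem id_app (E : EqSheaf G X R) (x : X) (a : E.stalk x) : Hom.app (𝟙 E) x a = a := rfl

@[simp]
theorem comp_app {E F K : EqSheaf G X R} (f : E ⟶ F) (g : F ⟶ K) (x : X) (a : E.stalk x) :
    (f ≫ g).app x a = g.app x (f.app x a) := rfl

variable (E : EqSheaf G X R)

/-- The identification of the stalks at two equal points. -/
def transport {x y : X} (h : x = y) : E.stalk x →ₗ[R] E.stalk y :=
  E.act 1 ((one_smul G x).trans h)

@[simp]
theorem transport_rfl {x : X} (a : E.stalk x) : E.transport rfl a = a := E.act_one x a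

theorem transport_transport {x y z : X} (h : x = y) (h' : y = z) (a : E.stalk x) :
    E.transport h' (E.transport h a) = E.transport (h.trans h') a := by
  subst h; subst h'; simp

theorem etale_transport {x y : X} (h : x = y) (a : E.stalk x) :
    (⟨y, E.transport h a⟩ : Etale E.stalk) = ⟨x, a⟩ := by
  subst h; simp

theorem act_transport (g : G) {x x' y y' : X} (hx : x = x') (hy : y = y') (h : g • x = y)
    (h' : g • x' = y') (a : E.stalk x) :
    E.act g h' (E.transport hx a) = E.transport hy (E.act g h a) := by
  subst hx; subst hy; simp

theorem app_transport {E F : EqSheaf G X R} (f : E ⟶ F) {x y : X} (h : x = y) (a : E.stalk x) :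
    f.app y (E.transport h a) = F.transport h (f.app x a) := by
  subst h; simp

theorem act_inv_act (g : G) {x y : X} (h : g • x = y) (h' : g⁻¹ • y = x) (a : E.stalk x) :
    E.act g⁻¹ h' (E.act g h a) = a := by
  rw [← E.act_mul g⁻¹ g h h' (by simp)]
  have : ∀ (k : G) (hk : k • x = x), k = 1 → E.act k hk a = a := by
    rintro k hk rfl
    exact E.act_one x a
  exact this _ _ (by simp)

theorem act_congr {g g' : G} (hg : g = g') {x y : X} (h : g • x = y) (h' : g' • x = y)
    (a : E.stalk x) : E.act g h a = E.act g' h' a := by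
  subst hg; rfl

/-- Fibrewise difference of two continuous families of points of the sheaf space is continuous. -/
theorem continuous_mk_sub {T : Type*} [TopologicalSpace T] {b : T → X} {s t : ∀ i, E.stalk (b i)}
    (hs : Continuous fun i => (⟨b i, s i⟩ : Etale E.stalk))
    (ht : Continuous fun i => (⟨b i, t i⟩ : Etale E.stalk)) :
    Continuous fun i => (⟨b i, s i - t i⟩ : Etale E.stalk) := by
  let _ : TopologicalSpace (Etale fun x => E.stalk x × E.stalk x) :=
    TopologicalSpace.induced
      (fun q => ((⟨q.base, q.val.1⟩, ⟨q.base, q.val.2⟩) : Etale E.stalk × Etale E.stalk))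
      inferInstance
  have h1 : Continuous fun i => (⟨b i, (s i, t i)⟩ : Etale fun x => E.stalk x × E.stalk x) :=
    continuous_induced_rng.2 (hs.prodMk ht)
  exact E.continuous_sub.comp h1

theorem continuous_zero : Continuous fun x => (⟨x, 0⟩ : Etale E.stalk) := by
  have h : Continuous fun e : Etale E.stalk => (⟨e.base, 0⟩ : Etale E.stalk) :=
    (E.continuous_mk_sub (b := Etale.base) (s := fun e => e.val) (t := fun e => e.val)
      continuous_id continuous_id).congr fun e => by rw [sub_self]
  rw [continuous_iff_continuousAt]
  intro x
  rw [ContinuousAt, ← E.isLocalHomeomorph.map_nhds_eq ⟨x, 0⟩, Filter.tendsto_map'_iff]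
  exact h.tendsto (⟨x, 0⟩ : Etale E.stalk)

theorem continuous_mk_add {T : Type*} [TopologicalSpace T] {b : T → X} {s t : ∀ i, E.stalk (b i)}
    (hb : Continuous b) (hs : Continuous fun i => (⟨b i, s i⟩ : Etale E.stalk))
    (ht : Continuous fun i => (⟨b i, t i⟩ : Etale E.stalk)) :
    Continuous fun i => (⟨b i, s i + t i⟩ : Etale E.stalk) :=
  (E.continuous_mk_sub hs (E.continuous_mk_sub (E.continuous_zero.comp hb) ht)).congr
    fun i => by simp

end

end EqSheaf

/-- A map from a `G`-space `X` to an `H`-space `Y`: a continuous homomorphism `hom : G → H`,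
together with a continuous map `base : X → Y` such that `base (g x) = hom g • base x`. -/
structure SpaceMap (G X H Y : Type u) [Group G] [TopologicalSpace G] [TopologicalSpace X]
    [MulAction G X] [Group H] [TopologicalSpace H] [TopologicalSpace Y] [MulAction H Y] where
  hom : G →* H
  continuous_hom : Continuous hom
  base : X → Y
  continuous_base : Continuous base
  base_smul : ∀ (g : G) (x : X), base (g • x) = hom g • base x

namespace EqSheaf

section

variable {G X H Y : Type u} [Group G] [TopologicalSpace G] [TopologicalSpace X] [MulAction G X]
  [Group H] [TopologicalSpace H] [TopologicalSpace Y] [MulAction H Y] {R : Type w} [Ring R]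

/-- The map from the total space of the pulled back stalks to the fibre product `X × D`. -/
def pullbackMap (p : SpaceMap G X H Y) (D : EqSheaf H Y R)
    (e : Etale fun x => D.stalk (p.base x)) : X × Etale D.stalk :=
  (e.base, ⟨p.base e.base, e.val⟩)

/-- The pullback `p̄^* D` with change of group: its sheaf space is the fibre product `X ×_Y D`
(the stalk at `x` is `D_{p x}`), and `G` acts on `D` through `G → H`. -/
def pullbackObj [ContinuousSMul G X] (p : SpaceMap G X H Y) (D : EqSheaf H Y R) :
    EqSheaf G X R where
  stalk x := D.stalk (p.base x)
  topology := TopologicalSpace.induced (pullbackMap p D) inferInstance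
  isLocalHomeomorph := by
    let _ : TopologicalSpace (Etale fun x => D.stalk (p.base x)) :=
      TopologicalSpace.induced (pullbackMap p D) inferInstance
    have hc : Continuous (pullbackMap p D) := continuous_induced_dom
    have hbase : Continuous (Etale.base : (Etale fun x => D.stalk (p.base x)) → X) :=
      continuous_fst.comp hc
    have hval : Continuous fun e : (Etale fun x => D.stalk (p.base x)) =>
        (⟨p.base e.base, e.val⟩ : Etale D.stalk) := continuous_snd.comp hc
    have hopen : IsOpenMap (Etale.base : (Etale fun x => D.stalk (p.base x)) → X) := by
      intro U hU
      obtain ⟨V, hV, rfl⟩ := isOpen_induced_iff.1 hU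
      rw [isOpen_iff_forall_mem_open]
      rintro x ⟨e, he, rfl⟩
      obtain ⟨A, B, hA, hB, h1, h2, hAB⟩ := isOpen_prod_iff.1 hV _ _ he
      refine ⟨A ∩ p.base ⁻¹' (Etale.base '' B), ?_,
        hA.inter ((D.isLocalHomeomorph.isOpenMap _ hB).preimage p.continuous_base),
        h1, ⟨_, h2, rfl⟩⟩
      rintro x ⟨hxA, ⟨y, b⟩, hb, hy⟩
      dsimp at hy
      subst hy
      exact ⟨⟨x, b⟩, hAB ⟨hxA, hb⟩, rfl⟩
    rw [isLocalHomeomorph_iff_isOpenEmbedding_restrict]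
    intro e
    obtain ⟨V, hV, hemb⟩ := isLocalHomeomorph_iff_isOpenEmbedding_restrict.1 D.isLocalHomeomorph
      ⟨p.base e.base, e.val⟩
    obtain ⟨V', hV'V, hV'o, hV'm⟩ := mem_nhds_iff.1 hV
    refine ⟨(fun e => (⟨p.base e.base, e.val⟩ : Etale D.stalk)) ⁻¹' V',
      (hV'o.preimage hval).mem_nhds hV'm, ?_⟩
    refine IsOpenEmbedding.of_continuous_injective_isOpenMap
      (hbase.comp continuous_subtype_val) ?_ (hopen.domRestrict (hV'o.preimage hval))
    rintro ⟨⟨x, a⟩, ha⟩ ⟨⟨x', a'⟩, ha'⟩ h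
    dsimp at h
    subst h
    have := @hemb.injective ⟨⟨p.base x, a⟩, hV'V ha⟩ ⟨⟨p.base x, a'⟩, hV'V ha'⟩ rfl
    simp only [Subtype.mk.injEq, Etale.mk.injEq, heq_eq_eq, true_and] at this
    subst this
    rfl
  continuous_sub := by
    let _ : TopologicalSpace (Etale fun x => D.stalk (p.base x)) :=
      TopologicalSpace.induced (pullbackMap p D) inferInstance
    have hc : Continuous (pullbackMap p D) := continuous_induced_dom
    let _ : TopologicalSpace (Etale fun x => D.stalk (p.base x) × D.stalk (p.base x)) :=
      TopologicalSpace.induced (fun q => ((⟨q.base, q.val.1⟩, ⟨q.base, q.val.2⟩) :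
        (Etale fun x => D.stalk (p.base x)) × (Etale fun x => D.stalk (p.base x)))) inferInstance
    have hd : Continuous (fun q : (Etale fun x => D.stalk (p.base x) × D.stalk (p.base x)) =>
        ((⟨q.base, q.val.1⟩, ⟨q.base, q.val.2⟩) :
        (Etale fun x => D.stalk (p.base x)) × (Etale fun x => D.stalk (p.base x)))) :=
      continuous_induced_dom
    refine continuous_induced_rng.2 (Continuous.prodMk ?_ ?_)
    · exact (continuous_fst.comp hc).comp (continuous_fst.comp hd)
    · exact D.continuous_mk_sub (b := fun q : (Etale fun x => D.stalk (p.base x) × D.stalk (p.base x)) => p.base q.base)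
        (s := fun q => q.val.1) (t := fun q => q.val.2) ((continuous_snd.comp hc).comp (continuous_fst.comp hd))
        ((continuous_snd.comp hc).comp (continuous_snd.comp hd))
  continuous_smul r := by
    let _ : TopologicalSpace (Etale fun x => D.stalk (p.base x)) :=
      TopologicalSpace.induced (pullbackMap p D) inferInstance
    have hc : Continuous (pullbackMap p D) := continuous_induced_dom
    exact continuous_induced_rng.2 ((continuous_fst.comp hc).prodMk
      ((D.continuous_smul r).comp (continuous_snd.comp hc)))
  act g x y h := D.act (p.hom g) (by rw [← p.base_smul, h])
  act_one x a := by
    rw [D.act_congr (map_one p.hom) _ (one_smul H _)]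
    exact D.act_one _ a
  act_mul g h x y z hxy hyz hxz a := by
    have e : (p.hom g * p.hom h) • p.base x = p.base z := by
      rw [← map_mul, ← p.base_smul, hxz]
    rw [D.act_congr (map_mul p.hom g h) _ e]
    exact D.act_mul _ _ _ _ _ a
  continuous_act := by
    let _ : TopologicalSpace (Etale fun x => D.stalk (p.base x)) :=
      TopologicalSpace.induced (pullbackMap p D) inferInstance
    have hc : Continuous (pullbackMap p D) := continuous_induced_dom
    refine continuous_induced_rng.2 (Continuous.prodMk ?_ ?_)
    · exact continuous_fst.smul ((continuous_fst.comp hc).comp continuous_snd)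
    · have h1 : Continuous fun q : G × Etale fun x => D.stalk (p.base x) =>
          (p.hom q.1, (⟨p.base q.2.base, q.2.val⟩ : Etale D.stalk)) :=
        (p.continuous_hom.comp continuous_fst).prodMk
          ((continuous_snd.comp hc).comp continuous_snd)
      refine (D.continuous_act.comp h1).congr fun q => ?_
      have key : ∀ {y : Y} (h : p.hom q.1 • p.base q.2.base = y),
          (⟨p.hom q.1 • p.base q.2.base, D.act (p.hom q.1) rfl q.2.val⟩ : Etale D.stalk)
            = ⟨y, D.act (p.hom q.1) h q.2.val⟩ := by
        rintro y rfl; rfl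
      exact key _

/-- The pullback functor `p̄^*`. -/
def pullback [ContinuousSMul G X] (R : Type w) [Ring R] (p : SpaceMap G X H Y) :
    EqSheaf H Y R ⥤ EqSheaf G X R where
  obj D := pullbackObj p D
  map {D D'} f :=
    { app := fun x => f.app (p.base x)
      continuous_map := by
        have hc : @Continuous _ _ (pullbackObj p D).topology _ (pullbackMap p D) :=
          continuous_induced_dom
        exact continuous_induced_rng.2 ((continuous_fst.comp hc).prodMk
          (f.continuous_map.comp (continuous_snd.comp hc)))
      equivariant := fun g x y h a => f.equivariant _ _ _ }

/-- `Γ(p⁻¹{y}, E)^N`, for `N` the kernel of `G → H`: the continuous sections of `E` over the fibre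
of `p` at `y` that are `N`-equivariant. -/
def fixedSections (p : SpaceMap G X H Y) (E : EqSheaf G X R) (y : Y) :
    Submodule R (∀ x : {x // p.base x = y}, E.stalk x.1) where
  carrier := {s | (Continuous fun x : {x // p.base x = y} => (⟨x.1, s x⟩ : Etale E.stalk)) ∧
    ∀ n ∈ p.hom.ker, ∀ (x x' : {x // p.base x = y}) (h : n • x.1 = x'.1),
      E.act n h (s x) = s x'}
  zero_mem' := ⟨E.continuous_zero.comp continuous_subtype_val, fun n hn x x' h => by simp⟩
  add_mem' hs ht := ⟨E.continuous_mk_add continuous_subtype_val hs.1 ht.1,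
    fun n hn x x' h => by simp [hs.2 n hn x x' h, ht.2 n hn x x' h]⟩
  smul_mem' r s hs := ⟨(E.continuous_smul r).comp hs.1, fun n hn x x' h => by
    simp [hs.2 n hn x x' h]⟩

theorem fixedSections_act {p : SpaceMap G X H Y} {E : EqSheaf G X R} {y : Y}
    (s : fixedSections p E y) {n : G} (hn : p.hom n = 1) {x x' : X} (hx : p.base x = y)
    (hx' : p.base x' = y) (h : n • x = x') : E.act n h (s.1 ⟨x, hx⟩) = s.1 ⟨x', hx'⟩ :=
  s.2.2 n hn ⟨x, hx⟩ ⟨x', hx'⟩ h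

theorem base_inv_smul (p : SpaceMap G X H Y) (g : G) {y y' : Y} (hy : p.hom g • y = y') {x : X}
    (hx : p.base x = y') : p.base (g⁻¹ • x) = y := by
  rw [p.base_smul, hx, ← hy, map_inv, inv_smul_smul]

/-- Translation of sections, `s ↦ g ∗ s = g ∘ s ∘ g⁻¹`. -/
def translate [ContinuousSMul G X] (p : SpaceMap G X H Y) (E : EqSheaf G X R) (g : G) {y y' : Y}
    (hy : p.hom g • y = y') : fixedSections p E y →ₗ[R] fixedSections p E y' where
  toFun s := ⟨fun x => E.act g (smul_inv_smul g x.1)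
      (s.1 ⟨g⁻¹ • x.1, base_inv_smul p g hy x.2⟩), by
    constructor
    · have h1 : Continuous fun x : {x // p.base x = y'} =>
          (⟨g⁻¹ • x.1, base_inv_smul p g hy x.2⟩ : {x // p.base x = y}) :=
        Continuous.subtype_mk (continuous_subtype_val.const_smul g⁻¹) _
      refine (E.continuous_act.comp (continuous_const (y := g).prodMk (s.2.1.comp h1))).congr
        fun x => ?_
      have key : ∀ {z : X} (h : g • g⁻¹ • x.1 = z) (a : E.stalk (g⁻¹ • x.1)),
          (⟨g • g⁻¹ • x.1, E.act g rfl a⟩ : Etale E.stalk) = ⟨z, E.act g h a⟩ := by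
        rintro z rfl a; rfl
      exact key _ _
    · rintro n hn ⟨x, hx⟩ ⟨x', hx'⟩ h
      dsimp only at h ⊢
      subst h
      have hk : p.hom (g⁻¹ * n * g) = 1 := by
        rw [map_mul, map_mul, map_inv, MonoidHom.mem_ker.1 hn]; simp
      rw [← fixedSections_act s hk (base_inv_smul p g hy hx) (base_inv_smul p g hy hx')
        (by simp [mul_smul]), ← E.act_mul n g (smul_inv_smul g x) rfl (by simp [mul_smul]),
        ← E.act_mul g (g⁻¹ * n * g) _ (smul_inv_smul g (n • x)) (by simp [mul_smul])]
      exact E.act_congr (by group) _ _ _⟩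
  map_add' s t := by ext x; simp
  map_smul' r s := by ext x; simp

theorem translate_apply [ContinuousSMul G X] (p : SpaceMap G X H Y) (E : EqSheaf G X R) {g k : G}
    (hk : p.hom k = p.hom g) {y y' : Y} (hy : p.hom g • y = y') (s : fixedSections p E y)
    {x x' : X} (hx : p.base x = y) (hx' : p.base x' = y') (h : k • x = x') :
    (translate p E g hy s).1 ⟨x', hx'⟩ = E.act k h (s.1 ⟨x, hx⟩) := by
  have hn : p.hom (g⁻¹ * k) = 1 := by simp [hk]
  change E.act g _ (s.1 ⟨g⁻¹ • x', _⟩) = _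
  rw [← fixedSections_act s hn hx (base_inv_smul p g hy hx') (by rw [mul_smul, h]),
    ← E.act_mul g (g⁻¹ * k) _ _ (by simpa using h)]
  exact E.act_congr (by group) _ _ _

/-- The pushforward `p̄_* E` with change of group, along `X → Y` and a surjection `G → H` with
kernel `N`, for discrete `H` and `Y`. It is the sheaf `V ↦ E(p⁻¹ V)^N` over the discrete space `Y`,
so its sheaf space is the disjoint union of the modules `E(p⁻¹{y})^N` with the discrete topology;
`h = p(g) ∈ H` acts by `s ↦ g ∗ s`, which does not depend on the choice of `g`. -/
noncomputable def pushforwardObj [ContinuousSMul G X] [DiscreteTopology H] [DiscreteTopology Y]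
    (p : SpaceMap G X H Y) (hp : Function.Surjective p.hom) (E : EqSheaf G X R) :
    EqSheaf H Y R where
  stalk y := fixedSections p E y
  topology := ⊥
  isLocalHomeomorph := by
    let _ : TopologicalSpace (Etale fun y => fixedSections p E y) := ⊥
    have : DiscreteTopology (Etale fun y => fixedSections p E y) := ⟨rfl⟩
    rw [isLocalHomeomorph_iff_isOpenEmbedding_restrict]
    refine fun e => ⟨{e}, by simp, ?_⟩
    exact IsOpenEmbedding.of_continuous_injective_isOpenMap continuous_of_discreteTopology
      (Function.injective_of_subsingleton _) fun U _ => isOpen_discrete _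
  continuous_sub := by
    let _ : TopologicalSpace (Etale fun y => fixedSections p E y) := ⊥
    have : DiscreteTopology (Etale fun y => fixedSections p E y) := ⟨rfl⟩
    let _ : TopologicalSpace (Etale fun x => fixedSections p E x × fixedSections p E x) :=
      TopologicalSpace.induced (fun q => ((⟨q.base, q.val.1⟩, ⟨q.base, q.val.2⟩) :
        (Etale fun x => fixedSections p E x) × (Etale fun x => fixedSections p E x))) inferInstance
    have : DiscreteTopology (Etale fun x => fixedSections p E x × fixedSections p E x) := by
      refine DiscreteTopology.of_continuous_injective
        (f := fun q => ((⟨q.base, q.val.1⟩, ⟨q.base, q.val.2⟩) :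
          (Etale fun x => fixedSections p E x) × (Etale fun x => fixedSections p E x)))
        continuous_induced_dom ?_
      rintro ⟨x, a, b⟩ ⟨x', a', b'⟩ h
      simp only [Prod.mk.injEq, Etale.mk.injEq] at h
      obtain ⟨⟨rfl, h1⟩, -, h2⟩ := h
      obtain rfl := eq_of_heq h1
      obtain rfl := eq_of_heq h2
      rfl
    exact continuous_of_discreteTopology
  continuous_smul r := by
    let _ : TopologicalSpace (Etale fun y => fixedSections p E y) := ⊥
    exact continuous_bot
  act h y y' hy := translate p E (Function.surjInv hp h)
    (by rw [Function.surjInv_eq hp, hy])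
  act_one y s := by
    ext ⟨x, hx⟩
    rw [translate_apply p E (k := 1) (by rw [Function.surjInv_eq hp, map_one]) _ s hx hx
      (one_smul G x)]
    exact E.act_one _ _
  act_mul g h y y' y'' h₁ h₂ h₃ s := by
    ext ⟨x, hx⟩
    obtain ⟨g, rfl⟩ := hp g
    obtain ⟨h, rfl⟩ := hp h
    have e1 : p.base (g⁻¹ • x) = y' := base_inv_smul p g h₂ hx
    have e2 : p.base (h⁻¹ • g⁻¹ • x) = y := base_inv_smul p h h₁ e1
    rw [translate_apply p E (k := g * h) (by rw [Function.surjInv_eq hp, map_mul]) _ s e2 hx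
      (by simp [mul_smul]), translate_apply p E (k := g) (by rw [Function.surjInv_eq hp]) _ _ e1 hx
      (by simp), translate_apply p E (k := h) (by rw [Function.surjInv_eq hp]) _ _ e2 e1
      (by simp)]
    exact E.act_mul _ _ _ _ _ _
  continuous_act := by
    let _ : TopologicalSpace (Etale fun y => fixedSections p E y) := ⊥
    have : DiscreteTopology (Etale fun y => fixedSections p E y) := ⟨rfl⟩
    exact continuous_of_discreteTopology

/-- Composition of sections with a map of sheaves. -/
def mapSections (p : SpaceMap G X H Y) {E E' : EqSheaf G X R} (f : E ⟶ E') (y : Y) :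
    fixedSections p E y →ₗ[R] fixedSections p E' y where
  toFun s := ⟨fun x => f.app x.1 (s.1 x), f.continuous_map.comp s.2.1,
    fun n hn x x' h => by rw [← f.equivariant, s.2.2 n hn x x' h]⟩
  map_add' s t := by ext x; simp
  map_smul' r s := by ext x; simp

/-- The pushforward functor `p̄_*`: a map `f` acts on sections by `s ↦ f ∘ s`. -/
noncomputable def pushforward [ContinuousSMul G X] [DiscreteTopology H] [DiscreteTopology Y]
    (R : Type w) [Ring R] (p : SpaceMap G X H Y) (hp : Function.Surjective p.hom) :
    EqSheaf G X R ⥤ EqSheaf H Y R where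
  obj E := pushforwardObj p hp E
  map {E E'} f :=
    { app := fun y => mapSections p f y
      continuous_map := by
        have : DiscreteTopology (Etale (pushforwardObj p hp E).stalk) := ⟨rfl⟩
        exact continuous_of_discreteTopology
      equivariant := fun g y y' h s => Subtype.ext (funext fun x => f.equivariant _ _ _) }

theorem discreteTopology_etale [DiscreteTopology Y] (D : EqSheaf H Y R) :
    DiscreteTopology (Etale D.stalk) := by
  rw [discreteTopology_iff_isOpen_singleton]
  intro e
  obtain ⟨V, hV, hemb⟩ := isLocalHomeomorph_iff_isOpenEmbedding_restrict.1 D.isLocalHomeomorph e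
  obtain ⟨V', hV'V, hV'o, hV'm⟩ := mem_nhds_iff.1 hV
  convert hV'o.inter ((isOpen_discrete {e.base}).preimage D.isLocalHomeomorph.continuous) using 1
  ext e'
  constructor
  · rintro rfl
    exact ⟨hV'm, rfl⟩
  · rintro ⟨h1, h2⟩
    exact congrArg Subtype.val (@hemb.injective ⟨e', hV'V h1⟩ ⟨e, hV'V hV'm⟩ h2)

/-- A map `p̄^* D → E` on the stalk at `x`, as a map `D_{p x} → E_x`. -/
def pullbackApp [ContinuousSMul G X] {p : SpaceMap G X H Y} {D : EqSheaf H Y R}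
    {E : EqSheaf G X R} (f : (pullback R p).obj D ⟶ E) (x : X) :
    D.stalk (p.base x) →ₗ[R] E.stalk x :=
  f.app x

theorem pullbackApp_act [ContinuousSMul G X] {p : SpaceMap G X H Y} {D : EqSheaf H Y R}
    {E : EqSheaf G X R} (f : (pullback R p).obj D ⟶ E) (g : G) {x x' : X} (h : g • x = x')
    (h' : p.hom g • p.base x = p.base x') (a : D.stalk (p.base x)) :
    E.act g h (pullbackApp f x a) = pullbackApp f x' (D.act (p.hom g) h' a) :=
  (f.equivariant g h a).symm

/-- The section `x ↦ f_x(a)` of `E` over `p⁻¹{y}` defined by `a ∈ D_y`. -/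
def adjunctApp [ContinuousSMul G X] {p : SpaceMap G X H Y} {D : EqSheaf H Y R}
    {E : EqSheaf G X R} (f : (pullback R p).obj D ⟶ E) (y : Y) :
    D.stalk y →ₗ[R] fixedSections p E y where
  toFun a := ⟨fun x => pullbackApp f x.1 (D.transport x.2.symm a), by
    constructor
    · have h1 : Continuous fun x : {x // p.base x = y} =>
          (⟨x.1, D.transport x.2.symm a⟩ : Etale ((pullback R p).obj D).stalk) := by
        refine continuous_induced_rng.2 (continuous_subtype_val.prodMk ?_)
        exact (continuous_const (y := (⟨y, a⟩ : Etale D.stalk))).congr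
          fun x => (D.etale_transport _ _).symm
      exact f.continuous_map.comp h1
    · rintro n hn ⟨x, hx⟩ ⟨x', hx'⟩ h
      have hn1 : p.hom n = 1 := hn
      dsimp only at h ⊢
      rw [pullbackApp_act f n h (by rw [hn1, one_smul, hx, hx'])]
      congr 1
      subst hx
      rw [D.act_congr hn1 _ (by rw [one_smul, hx'])]
      exact D.transport_transport rfl hx'.symm a⟩
  map_add' a b := by ext x; simp
  map_smul' r a := by ext x; simp

/-- The adjoint `D → p̄_* E` of a map `f : p̄^* D → E`: it sends `a ∈ D_y` to the section
`x ↦ f_x(a)` of `E` over `p⁻¹{y}`. -/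
noncomputable def adjunct [ContinuousSMul G X] [DiscreteTopology H] [DiscreteTopology Y]
    (p : SpaceMap G X H Y) (hp : Function.Surjective p.hom) {D : EqSheaf H Y R}
    {E : EqSheaf G X R} (f : (pullback R p).obj D ⟶ E) : D ⟶ (pushforward R p hp).obj E where
  app y := adjunctApp f y
  continuous_map := by
    have := discreteTopology_etale D
    exact continuous_of_discreteTopology
  equivariant h y y' hy a := by
    refine Subtype.ext (funext ?_)
    rintro ⟨x, hx⟩
    obtain ⟨g, rfl⟩ := hp h
    have e : p.base (g⁻¹ • x) = y := base_inv_smul p g hy hx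
    refine Eq.trans ?_ (translate_apply p E (k := g) (g := Function.surjInv hp (p.hom g))
      (by rw [Function.surjInv_eq hp]) (by rw [Function.surjInv_eq hp, hy]) (adjunctApp f y a)
      e hx (smul_inv_smul g x)).symm
    refine Eq.trans ?_ (pullbackApp_act f g (smul_inv_smul g x)
      (by rw [← p.base_smul, smul_inv_smul]) _).symm
    exact congrArg (pullbackApp f x) (D.act_transport _ _ _ _ _ _).symm

end

end EqSheaf

/-! ### The space of closed subgroups -/

/-- The set `S G` of closed subgroups of `G`. -/
def SubgroupSpace (G : Type u) [Group G] [TopologicalSpace G] : Type u := ClosedSubgroup G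

namespace SubgroupSpace

section

variable {G : Type u} [Group G] [TopologicalSpace G]

/-- The underlying subgroup of a point of `S G`. -/
def toSubgroup (K : SubgroupSpace G) : Subgroup G := ClosedSubgroup.toSubgroup K

@[ext]
theorem ext {K L : SubgroupSpace G} (h : K.toSubgroup = L.toSubgroup) : K = L :=
  ClosedSubgroup.toSubgroup_injective h

/-- The basic set `O(N, NK) = {L | LN/N = KN/N} = {L | NL = NK}`. -/
def basicOpen (N : OpenNormalSubgroup G) (K : SubgroupSpace G) : Set (SubgroupSpace G) :=
  {L | L.toSubgroup.map (QuotientGroup.mk' N.toSubgroup) =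
    K.toSubgroup.map (QuotientGroup.mk' N.toSubgroup)}

/-- The topology on `S G` generated by the sets `O(N, NK)`, `N` open normal in `G`. -/
instance : TopologicalSpace (SubgroupSpace G) :=
  TopologicalSpace.generateFrom {U | ∃ N K, U = basicOpen N K}

theorem isOpen_basicOpen (N : OpenNormalSubgroup G) (K : SubgroupSpace G) :
    IsOpen (basicOpen N K) :=
  TopologicalSpace.isOpen_generateFrom_of_mem ⟨N, K, rfl⟩

theorem isOpen_preimage_map {Q : Type u} [Group Q] [TopologicalSpace Q] [DiscreteTopology Q]
    (f : G →* Q) (hf : Continuous f) (S : Set (Subgroup Q)) :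
    IsOpen {L : SubgroupSpace G | L.toSubgroup.map f ∈ S} := by
  let N : OpenNormalSubgroup G :=
    { f.ker with
      isOpen' := (isOpen_discrete {(1 : Q)}).preimage hf
      isNormal' := f.normal_ker }
  rw [isOpen_iff_forall_mem_open]
  intro L hL
  refine ⟨basicOpen N L, fun L' hL' => ?_, isOpen_basicOpen N L, rfl⟩
  have h : L'.toSubgroup.map f = L.toSubgroup.map f := by
    have h1 := congrArg (Subgroup.map (QuotientGroup.kerLift f)) hL'
    have h2 : (QuotientGroup.kerLift f).comp (QuotientGroup.mk' f.ker) = f := by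
      ext x; rfl
    have h3 : ∀ K : Subgroup G, (K.map (QuotientGroup.mk' f.ker)).map (QuotientGroup.kerLift f)
        = K.map f := fun K => by rw [Subgroup.map_map, h2]
    exact (h3 _).symm.trans (h1.trans (h3 _))
  exact (congrArg (· ∈ S) h).mpr hL

instance [DiscreteTopology G] : DiscreteTopology (SubgroupSpace G) := by
  refine discreteTopology_iff_isOpen_singleton.2 fun K => ?_
  convert isOpen_preimage_map (MonoidHom.id G) continuous_id {K.toSubgroup} using 1
  ext L
  simp [SubgroupSpace.ext_iff]

/-- The image `K ↦ f(K)` under a homomorphism to a discrete group. -/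
def map {Q : Type u} [Group Q] [TopologicalSpace Q] [DiscreteTopology Q] (f : G →* Q)
    (K : SubgroupSpace G) : SubgroupSpace Q :=
  { K.toSubgroup.map f with isClosed' := isClosed_discrete _ }

theorem continuous_map {Q : Type u} [Group Q] [TopologicalSpace Q] [DiscreteTopology Q]
    (f : G →* Q) (hf : Continuous f) : Continuous (map f) :=
  ⟨fun U _ => by
    convert isOpen_preimage_map f hf (toSubgroup '' U) using 1
    ext L
    constructor
    · exact fun h => ⟨_, h, rfl⟩
    · rintro ⟨K, hK, h⟩
      have : map f L = K := SubgroupSpace.ext h.symm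
      exact (congrArg (· ∈ U) this).mpr hK⟩

variable [IsTopologicalGroup G]

/-- `G` acts on `S G` by conjugation, `g • K = g K g⁻¹`. -/
instance : MulAction G (SubgroupSpace G) where
  smul g K :=
    { K.toSubgroup.map (MulAut.conj g).toMonoidHom with
      isClosed' := by
        have h : IsClosed ((fun x => g⁻¹ * x * g) ⁻¹' (K.toSubgroup : Set G)) :=
          (ClosedSubgroup.isClosed' K).preimage (by fun_prop)
        convert h using 1
        ext x
        constructor
        · rintro ⟨y, hy, rfl⟩
          simpa [mul_assoc] using hy
        · intro hx
          exact ⟨g⁻¹ * x * g, hx, by simp [mul_assoc]⟩ }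
  one_smul K := by
    refine SubgroupSpace.ext (?_ : K.toSubgroup.map (MulAut.conj 1).toMonoidHom = K.toSubgroup)
    rw [map_one]
    exact Subgroup.map_id _
  mul_smul g h K := by
    refine SubgroupSpace.ext (?_ : K.toSubgroup.map (MulAut.conj (g * h)).toMonoidHom =
      (K.toSubgroup.map (MulAut.conj h).toMonoidHom).map (MulAut.conj g).toMonoidHom)
    rw [Subgroup.map_map, map_mul]
    rfl

theorem toSubgroup_smul (g : G) (K : SubgroupSpace G) :
    (g • K).toSubgroup = K.toSubgroup.map (MulAut.conj g).toMonoidHom := rfl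

/-- Every `k ∈ K` stabilises `K`. -/
theorem smul_eq_self {K : SubgroupSpace G} {k : G} (hk : k ∈ K.toSubgroup) : k • K = K := by
  refine SubgroupSpace.ext (Subgroup.ext fun x => ?_)
  rw [toSubgroup_smul]
  constructor
  · rintro ⟨y, hy, rfl⟩
    exact K.toSubgroup.mul_mem (K.toSubgroup.mul_mem hk hy) (K.toSubgroup.inv_mem hk)
  · intro hx
    exact ⟨k⁻¹ * x * k, K.toSubgroup.mul_mem (K.toSubgroup.mul_mem (K.toSubgroup.inv_mem hk) hx) hk,
      by simp [mul_assoc]⟩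

theorem map_smul {Q : Type u} [Group Q] [TopologicalSpace Q] [DiscreteTopology Q]
    [IsTopologicalGroup Q] (f : G →* Q) (g : G) (K : SubgroupSpace G) :
    map f (g • K) = f g • map f K := by
  refine SubgroupSpace.ext ?_
  rw [toSubgroup_smul]
  change (K.toSubgroup.map _).map f = (K.toSubgroup.map f).map _
  rw [Subgroup.map_map,
    Subgroup.map_map]
  congr 1
  ext x
  simp

instance : ContinuousSMul G (SubgroupSpace G) where
  continuous_smul := by
    refine continuous_generateFrom_iff.2 ?_
    rintro _ ⟨N, K, rfl⟩
    have hc : Continuous fun q : G × SubgroupSpace G =>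
        ((QuotientGroup.mk' N.toSubgroup q.1, map (QuotientGroup.mk' N.toSubgroup) q.2) :
          (G ⧸ N.toSubgroup) × SubgroupSpace (G ⧸ N.toSubgroup)) :=
      (QuotientGroup.continuous_mk.comp continuous_fst).prodMk
        ((continuous_map _ QuotientGroup.continuous_mk).comp continuous_snd)
    convert (isOpen_discrete {r : (G ⧸ N.toSubgroup) × SubgroupSpace (G ⧸ N.toSubgroup) |
      r.1 • r.2 = map (QuotientGroup.mk' N.toSubgroup) K}).preimage hc using 1
    ext ⟨g, L⟩
    simp only [Set.mem_preimage, Set.mem_ofPred_eq, ← map_smul]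
    exact ⟨fun h => SubgroupSpace.ext h, fun h => congrArg toSubgroup h⟩

/-- The map of spaces with group action `S G → S Q` given by a continuous homomorphism `G → Q` to a
discrete group. -/
def spaceMap {Q : Type u} [Group Q] [TopologicalSpace Q] [DiscreteTopology Q]
    [IsTopologicalGroup Q] (f : G →* Q) (hf : Continuous f) :
    SpaceMap G (SubgroupSpace G) Q (SubgroupSpace Q) where
  hom := f
  continuous_hom := hf
  base := map f
  continuous_base := continuous_map f hf
  base_smul := map_smul f

end

end SubgroupSpace

/-! ### Diagrams of sheaves over the spaces `S (G/N)` -/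

section

variable {G : Type u} [Group G] [TopologicalSpace G] [IsTopologicalGroup G]

/-- The projection `p_N : S G → S (G/N)`, `K ↦ KN/N`, over `G → G/N`. -/
def projMap (N : OpenNormalSubgroup G) :
    SpaceMap G (SubgroupSpace G) (G ⧸ N.toSubgroup) (SubgroupSpace (G ⧸ N.toSubgroup)) :=
  SubgroupSpace.spaceMap (QuotientGroup.mk' N.toSubgroup) QuotientGroup.continuous_mk

/-- The projection `φ_{M,N} : S (G/M) → S (G/N)` over `G/M → G/N`, for `M ≤ N`. -/
def transMap {M N : OpenNormalSubgroup G} (h : M ≤ N) :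
    SpaceMap (G ⧸ M.toSubgroup) (SubgroupSpace (G ⧸ M.toSubgroup))
      (G ⧸ N.toSubgroup) (SubgroupSpace (G ⧸ N.toSubgroup)) :=
  SubgroupSpace.spaceMap (QuotientGroup.map M.toSubgroup N.toSubgroup (MonoidHom.id G) h)
    continuous_of_discreteTopology

theorem projMap_surjective (N : OpenNormalSubgroup G) : Function.Surjective (projMap N).hom :=
  QuotientGroup.mk'_surjective _

theorem transMap_surjective {M N : OpenNormalSubgroup G} (h : M ≤ N) :
    Function.Surjective (transMap h).hom :=
  fun x => QuotientGroup.induction_on x fun g => ⟨QuotientGroup.mk g, rfl⟩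

theorem transMap_refl (N : OpenNormalSubgroup G) (y : SubgroupSpace (G ⧸ N.toSubgroup)) :
    (transMap (le_refl N)).base y = y := by
  refine SubgroupSpace.ext (?_ : y.toSubgroup.map _ = y.toSubgroup)
  convert Subgroup.map_id y.toSubgroup using 2
  ext x
  rfl

theorem transMap_trans {L M N : OpenNormalSubgroup G} (h₁ : L ≤ M) (h₂ : M ≤ N)
    (y : SubgroupSpace (G ⧸ L.toSubgroup)) :
    (transMap (h₁.trans h₂)).base y = (transMap h₂).base ((transMap h₁).base y) := by
  refine SubgroupSpace.ext (?_ : y.toSubgroup.map _ = (y.toSubgroup.map _).map _)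
  rw [Subgroup.map_map]
  congr 1
  ext x
  rfl

theorem transMap_projMap {M N : OpenNormalSubgroup G} (h : M ≤ N) (K : SubgroupSpace G) :
    (projMap N).base K = (transMap h).base ((projMap M).base K) := by
  refine SubgroupSpace.ext (?_ : K.toSubgroup.map _ = (K.toSubgroup.map _).map _)
  rw [Subgroup.map_map]
  congr 1

end

open EqSheaf

/-- A `G_•`-sheaf of `R`-modules over `S G_•`: a `G/N`-sheaf `D_N` over `S (G/N)` for every open
normal subgroup `N`, and maps `α_{M,N} : φ̄_{M,N}^* D_N → D_M` of `G/M`-sheaves for `M ≤ N`, which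
are functorial in `M ≤ N`. (On stalks, `α_{M,N}` is a map `(D_N)_{φ y} → (D_M)_y`; the functoriality
uses the identifications `φ_{N,N} = id` and `φ_{L,N} = φ_{M,N} ∘ φ_{L,M}`.) -/
structure SheafDiagram (G : Type u) [Group G] [TopologicalSpace G] [IsTopologicalGroup G]
    (R : Type w) [Ring R] where
  sheaf : ∀ N : OpenNormalSubgroup G,
    EqSheaf (G ⧸ N.toSubgroup) (SubgroupSpace (G ⧸ N.toSubgroup)) R
  str : ∀ {M N : OpenNormalSubgroup G} (h : M ≤ N),
    (pullback R (transMap h)).obj (sheaf N) ⟶ sheaf M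
  str_refl : ∀ (N : OpenNormalSubgroup G) (y : SubgroupSpace (G ⧸ N.toSubgroup))
    (a : (sheaf N).stalk ((transMap (le_refl N)).base y)),
    pullbackApp (str (le_refl N)) y a = (sheaf N).transport (transMap_refl N y) a
  str_trans : ∀ {L M N : OpenNormalSubgroup G} (h₁ : L ≤ M) (h₂ : M ≤ N)
    (y : SubgroupSpace (G ⧸ L.toSubgroup))
    (a : (sheaf N).stalk ((transMap (h₁.trans h₂)).base y)),
    pullbackApp (str (h₁.trans h₂)) y a =
      pullbackApp (str h₁) y (pullbackApp (str h₂) ((transMap h₁).base y)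
        ((sheaf N).transport (transMap_trans h₁ h₂ y) a))

namespace SheafDiagram

variable {G : Type u} [Group G] [TopologicalSpace G] [IsTopologicalGroup G] {R : Type w} [Ring R]

/-- A map of diagrams: maps `D_N → D'_N` of `G/N`-sheaves commuting with the structure maps. -/
@[ext]
structure Hom (D D' : SheafDiagram G R) where
  app : ∀ N, D.sheaf N ⟶ D'.sheaf N
  comm : ∀ {M N : OpenNormalSubgroup G} (h : M ≤ N),
    D.str h ≫ app M = (pullback R (transMap h)).map (app N) ≫ D'.str h

instance : Category (SheafDiagram G R) where
  Hom := Hom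
  id D := ⟨fun _ => 𝟙 _, fun h => rfl⟩
  comp f g := ⟨fun N => f.app N ≫ g.app N, fun h => by
    ext x a
    have h1 := congrArg (fun k => EqSheaf.Hom.app k x a) (f.comm h)
    have h2 := congrArg (fun k => EqSheaf.Hom.app k x
      (((pullback R (transMap h)).map (f.app _)).app x a)) (g.comm h)
    exact (congrArg ((g.app _).app x) h1).trans h2⟩

/-- The adjoint structure map `ᾱ_{M,N} : D_N → (φ̄_{M,N})_* D_M`. -/
noncomputable def adjStr (D : SheafDiagram G R) {M N : OpenNormalSubgroup G} (h : M ≤ N) :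
    D.sheaf N ⟶ (pushforward R (transMap h) (transMap_surjective h)).obj (D.sheaf M) :=
  adjunct (transMap h) (transMap_surjective h) (D.str h)

end SheafDiagram

section

variable {G : Type u} [Group G] [TopologicalSpace G] [IsTopologicalGroup G] {R : Type w} [Ring R]

/-- Restriction of `N`-equivariant sections of `E` over `p_N⁻¹{φ y}` to `M`-equivariant sections
over `p_M⁻¹{y}`, for `M ≤ N` and `y ∈ S (G/M)`. -/
def restrictSections (E : EqSheaf G (SubgroupSpace G) R) {M N : OpenNormalSubgroup G} (h : M ≤ N)
    (y : SubgroupSpace (G ⧸ M.toSubgroup)) :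
    fixedSections (projMap N) E ((transMap h).base y) →ₗ[R] fixedSections (projMap M) E y where
  toFun s := ⟨fun K => s.1 ⟨K.1, by rw [transMap_projMap h, K.2]⟩, by
    constructor
    · exact s.2.1.comp (Continuous.subtype_mk continuous_subtype_val _)
    · intro n hn K K' hK
      refine s.2.2 n ?_ ⟨K.1, by rw [transMap_projMap h, K.2]⟩
        ⟨K'.1, by rw [transMap_projMap h, K'.2]⟩ hK
      have h1 : n ∈ M.toSubgroup := (QuotientGroup.eq_one_iff n).1 hn
      exact (QuotientGroup.eq_one_iff n).2 (h h1)⟩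
  map_add' s t := by ext x; simp
  map_smul' r s := by ext x; simp

/-- The diagram `p̄_• E` of a `G`-sheaf `E` over `S G`: it consists of the pushforwards
`(p̄_N)_* E`, and its structure maps restrict sections, that is, they are the adjoints of the
identifications `(p̄_N)_* E = (φ̄_{M,N})_* (p̄_M)_* E`. -/
noncomputable def pushDiagramObj (E : EqSheaf G (SubgroupSpace G) R) : SheafDiagram G R where
  sheaf N := (pushforward R (projMap N) (projMap_surjective N)).obj E
  str {M N} h :=
    { app := fun y => restrictSections E h y
      continuous_map := by
        have := discreteTopology_etale ((pullback R (transMap h)).obj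
          ((pushforward R (projMap N) (projMap_surjective N)).obj E))
        exact continuous_of_discreteTopology
      equivariant := fun k y y' hy s => by
        obtain ⟨g, rfl⟩ := projMap_surjective M k
        refine Subtype.ext (funext ?_)
        rintro ⟨K, hK⟩
        have e : (projMap M).base (g⁻¹ • K) = y := base_inv_smul (projMap M) g hy hK
        refine (translate_apply (projMap N) E (k := g) ?_ ?_ s ?_ ?_ (smul_inv_smul g K)).trans
          (translate_apply (projMap M) E (k := g) ?_ ?_ (restrictSections E h y s) e hK
            (smul_inv_smul g K)).symm
        · exact (Function.surjInv_eq (projMap_surjective N) _).symm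
        · rw [Function.surjInv_eq (projMap_surjective N), ← hy, (transMap h).base_smul]
        · rw [transMap_projMap h, e]
        · exact (Function.surjInv_eq (projMap_surjective M) _).symm
        · rw [Function.surjInv_eq (projMap_surjective M), hy] }
  str_refl N y s := by
    have key : ∀ {z : SubgroupSpace (G ⧸ N.toSubgroup)} (hz : z = y)
        (s : fixedSections (projMap N) E z) (K : SubgroupSpace G) (hK : (projMap N).base K = y),
        s.1 ⟨K, hK.trans hz.symm⟩ =
          (((pushforward R (projMap N) (projMap_surjective N)).obj E).transport hz s :
            fixedSections (projMap N) E y).1 ⟨K, hK⟩ := by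
      rintro z rfl s K hK
      exact congrArg (fun t : fixedSections (projMap N) E z => t.1 ⟨K, hK⟩)
        (transport_rfl ((pushforward R (projMap N) (projMap_surjective N)).obj E) s).symm
    refine Subtype.ext (funext ?_)
    rintro ⟨K, hK⟩
    exact key (transMap_refl N y) s K hK
  str_trans {L M N} h₁ h₂ y s := by
    have key : ∀ {z z' : SubgroupSpace (G ⧸ N.toSubgroup)} (hz : z = z')
        (s : fixedSections (projMap N) E z) (K : SubgroupSpace G) (hK : (projMap N).base K = z'),
        s.1 ⟨K, hK.trans hz.symm⟩ =
          (((pushforward R (projMap N) (projMap_surjective N)).obj E).transport hz s :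
            fixedSections (projMap N) E z').1 ⟨K, hK⟩ := by
      rintro z _ rfl s K hK
      exact congrArg (fun t : fixedSections (projMap N) E z => t.1 ⟨K, hK⟩)
        (transport_rfl ((pushforward R (projMap N) (projMap_surjective N)).obj E) s).symm
    refine Subtype.ext (funext ?_)
    rintro ⟨K, hK⟩
    exact key (transMap_trans h₁ h₂ y) s K _

/-- The functor `p̄_•` from `G`-sheaves over `S G` to diagrams. -/
noncomputable def pushDiagram (G : Type u) [Group G] [TopologicalSpace G] [IsTopologicalGroup G]
    (R : Type w) [Ring R] : EqSheaf G (SubgroupSpace G) R ⥤ SheafDiagram G R where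
  obj E := pushDiagramObj E
  map f :=
    { app := fun N => (pushforward R (projMap N) (projMap_surjective N)).map f
      comm := fun h => rfl }

/-- For a diagram `D` and `M ≤ N`, the map `(p̄_N)^* D_N = (p̄_M)^* (φ̄_{M,N})^* D_N → (p̄_M)^* D_M`
given by `α_{M,N}`. -/
def pullDiagramMap (D : SheafDiagram G R) {M N : OpenNormalSubgroup G} (h : M ≤ N) :
    (pullback R (projMap N)).obj (D.sheaf N) ⟶ (pullback R (projMap M)).obj (D.sheaf M) where
  app K := (pullbackApp (D.str h) ((projMap M).base K)).comp
    ((D.sheaf N).transport (transMap_projMap h K))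
  continuous_map := by
    let P := (pullback R (projMap N)).obj (D.sheaf N)
    have hc : @Continuous _ _ P.topology _ (pullbackMap (projMap N) (D.sheaf N)) :=
      continuous_induced_dom
    refine continuous_induced_rng.2 (Continuous.prodMk (continuous_fst.comp hc) ?_)
    have h1 : Continuous fun e : Etale P.stalk =>
        (⟨(projMap M).base e.base, (D.sheaf N).transport (transMap_projMap h e.base) e.val⟩ :
          Etale ((pullback R (transMap h)).obj (D.sheaf N)).stalk) := by
      refine continuous_induced_rng.2 (Continuous.prodMk
        ((projMap M).continuous_base.comp (continuous_fst.comp hc)) ?_)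
      exact (continuous_snd.comp hc).congr fun e => ((D.sheaf N).etale_transport _ _).symm
    exact (D.str h).continuous_map.comp h1
  equivariant g K K' hK a := by
    refine Eq.trans ?_ (pullbackApp_act (D.str h) ((projMap M).hom g)
      (by rw [← (projMap M).base_smul, hK])
      (by rw [← (transMap h).base_smul, ← (projMap M).base_smul, hK]) _).symm
    exact congrArg (pullbackApp (D.str h) _) ((D.sheaf N).act_transport _ _ _ _ _ _).symm

/-- The functor sending a diagram `D` of sheaves to the diagram `N ↦ (p̄_N)^* D_N` of `G`-sheaves
over `S G`, whose colimit is `colim_N (p̄_N)^* D_N`. It is covariant in reverse inclusions. -/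
def pullDiagram (G : Type u) [Group G] [TopologicalSpace G] [IsTopologicalGroup G]
    (R : Type w) [Ring R] :
    SheafDiagram G R ⥤ (OpenNormalSubgroup G)ᵒᵖ ⥤ EqSheaf G (SubgroupSpace G) R where
  obj D :=
    { obj := fun N => (pullback R (projMap N.unop)).obj (D.sheaf N.unop)
      map := fun f => pullDiagramMap D (leOfHom f.unop)
      map_id := fun N => by
        ext K a
        refine (D.str_refl N.unop ((projMap N.unop).base K) _).trans ?_
        refine ((D.sheaf N.unop).transport_transport _ _ a).trans ?_
        exact (D.sheaf N.unop).transport_rfl _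
      map_comp := fun {N M L} f g => by
        ext K a
        refine (D.str_trans (leOfHom g.unop) (leOfHom f.unop) ((projMap L.unop).base K) _).trans ?_
        refine congrArg (pullbackApp (D.str (leOfHom g.unop)) _) ?_
        refine (congrArg (pullbackApp (D.str (leOfHom f.unop)) _)
          ((D.sheaf N.unop).transport_transport _ _ a)).trans ?_
        have key : ∀ {z z' : SubgroupSpace (G ⧸ M.unop.toSubgroup)} (hz : z = z')
            (b : (D.sheaf N.unop).stalk ((transMap (leOfHom f.unop)).base z))
            (hz' : (transMap (leOfHom f.unop)).base z = (transMap (leOfHom f.unop)).base z'),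
            pullbackApp (D.str (leOfHom f.unop)) z' ((D.sheaf N.unop).transport hz' b) =
              (D.sheaf M.unop).transport hz (pullbackApp (D.str (leOfHom f.unop)) z b) := by
          rintro z _ rfl b hz'
          simp
        refine Eq.trans ?_ (key (transMap_projMap (leOfHom g.unop) K) _
          (congrArg (transMap _).base (transMap_projMap (leOfHom g.unop) K)))
        exact congrArg (pullbackApp (D.str (leOfHom f.unop)) _)
          ((D.sheaf N.unop).transport_transport _ _ a).symm }
  map {D D'} f :=
    { app := fun N => (pullback R (projMap N.unop)).map (f.app N.unop)
      naturality := fun {N M} k => by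
        ext K a
        have h1 := congrArg (fun t => EqSheaf.Hom.app t ((projMap M.unop).base K)
          ((D.sheaf N.unop).transport (transMap_projMap (leOfHom k.unop) K) a))
          (f.comm (leOfHom k.unop))
        refine Eq.trans h1 ?_
        exact congrArg (pullbackApp (D'.str (leOfHom k.unop)) ((projMap M.unop).base K))
          (app_transport (f.app N.unop) _ a) }

/-- Weyl-`G`-sheaves: the stalk `E_K` is fixed by `K`, for every closed subgroup `K`. -/
def isWeyl (G : Type u) [Group G] [TopologicalSpace G] [IsTopologicalGroup G]
    (R : Type w) [Ring R] : ObjectProperty (EqSheaf G (SubgroupSpace G) R) := fun E =>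
  ∀ (K : SubgroupSpace G) (k : G) (hk : k ∈ K.toSubgroup) (a : E.stalk K),
    E.act k (SubgroupSpace.smul_eq_self hk) a = a

/-- The category of Weyl-`G`-sheaves of `R`-modules, a full subcategory. -/
abbrev WeylSheaf (G : Type u) [Group G] [TopologicalSpace G] [IsTopologicalGroup G]
    (R : Type w) [Ring R] := (isWeyl G R).FullSubcategory

/-- The diagrams of Weyl sheaves, all of whose adjoint structure maps are isomorphisms. -/
def isCompatibleWeyl (G : Type u) [Group G] [TopologicalSpace G] [IsTopologicalGroup G]
    (R : Type w) [Ring R] : ObjectProperty (SheafDiagram G R) := fun D =>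
  (∀ N, isWeyl (G ⧸ N.toSubgroup) R (D.sheaf N)) ∧
    ∀ (M N : OpenNormalSubgroup G) (h : M ≤ N), IsIso (D.adjStr h)

/-- The full subcategory of diagrams of Weyl sheaves with invertible adjoint structure maps. -/
abbrev CompatibleWeylDiagram (G : Type u) [Group G] [TopologicalSpace G] [IsTopologicalGroup G]
    (R : Type w) [Ring R] := (isCompatibleWeyl G R).FullSubcategory

end

/-! The basic open sets of `SubgroupSpace G` are the fibres of the maps p_N, so "near K" means "on
the fibre of p_M through K, for some smaller M". Sheaf data over S G can therefore be read off from
sections over such fibres, and the two composites of the functors can be compared with the identity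
on stalks.

Filtered colimits of equivariant sheaves are computed stalkwise (`filteredCocone`,
`isColimitFilteredCocone`): a germ of the colimit comes from some stage, and two germs agree exactly
when they agree at a later stage.

Counit: sections evaluate to germs, which gives colim p_N^*(p_N)_*E → E. It is injective on stalks
because a section that vanishes at K vanishes near K, hence becomes zero at a later stage. It is
surjective because every germ extends to a section near K which, by continuity of the action, is
equivariant for a small N (`exists_fixedSection`); here the open normal subgroups must be a basis at
1. This works for every G-sheaf E (`isIso_desc_evalCocone`).

Unit: D_N → (p_N)_* colim sends a germ to the section it defines. Equalities and representatives in
the colimit exist at a stage depending on K; since S G is compact, one stage M serves a whole fibre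
of p_N (`exists_uniform`). At this stage there is a family of germs of D_M over the fibre of
φ_{M,N}, and the assumption that D_N → (φ_{M,N})_*D_M is an isomorphism brings it back to D_N
(`coconeSection_injective`, `coconeSection_surjective`).

It remains to see that both functors respect the two full subcategories. The Weyl condition passes
in both directions because K maps onto KN/N (`isWeyl_pushforward`, `isWeyl_of_isColimit`), and the
adjoint structure maps of p_•E are invertible because sections over a fibre of p_N are glued from
sections over the open fibres of p_M inside it (`isIso_adjStr_pushDiagram`). -/

/-- A continuous open locally injective map is a local homeomorphism. -/
theorem isLocalHomeomorph_of_isOpenMap {A B : Type*} [TopologicalSpace A] [TopologicalSpace B]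
    {f : A → B} (hc : Continuous f) (ho : IsOpenMap f)
    (hi : ∀ a, ∃ U, IsOpen U ∧ a ∈ U ∧ Set.InjOn f U) : IsLocalHomeomorph f := by
  rw [isLocalHomeomorph_iff_isOpenEmbedding_restrict]
  intro a
  obtain ⟨U, hU, ha, hinj⟩ := hi a
  exact ⟨U, hU.mem_nhds ha, IsOpenEmbedding.of_continuous_injective_isOpenMap
    (hc.comp continuous_subtype_val) hinj.injective (ho.domRestrict hU)⟩

theorem IsLocalHomeomorph.exists_injOn {A B : Type*} [TopologicalSpace A] [TopologicalSpace B]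
    {f : A → B} (hf : IsLocalHomeomorph f) (a : A) : ∃ U, IsOpen U ∧ a ∈ U ∧ Set.InjOn f U := by
  obtain ⟨e, he, rfl⟩ := hf a
  exact ⟨e.source, e.open_source, he, e.injOn⟩

/-! ### Maps of equivariant sheaves and their stalks -/

namespace EqSheaf

variable {G X : Type u} [Group G] [TopologicalSpace G] [TopologicalSpace X] [MulAction G X]
  {R : Type w} [Ring R]

/-- The map of sheaf spaces underlying a map of sheaves. -/
def Hom.etale {E F : EqSheaf G X R} (f : E ⟶ F) (e : Etale E.stalk) : Etale F.stalk :=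
  ⟨e.base, f.app e.base e.val⟩

theorem Hom.continuous_etale {E F : EqSheaf G X R} (f : E ⟶ F) : Continuous (Hom.etale f) :=
  f.continuous_map

/-- Both projections to X are local homeomorphisms, and these cancel on the left. What is used later
is that maps of sheaves are open. -/
theorem Hom.isLocalHomeomorph_etale {E F : EqSheaf G X R} (f : E ⟶ F) :
    IsLocalHomeomorph (Hom.etale f) :=
  IsLocalHomeomorph.of_comp (g := (Etale.base : Etale F.stalk → X)) E.isLocalHomeomorph
    F.isLocalHomeomorph (Hom.continuous_etale f)

/-- A map of sheaves that is bijective on stalks is an isomorphism. -/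
theorem isIso_of_bijective {E F : EqSheaf G X R} (f : E ⟶ F)
    (hf : ∀ x, Function.Bijective (f.app x)) : IsIso f := by
  let e : ∀ x, E.stalk x ≃ₗ[R] F.stalk x := fun x => LinearEquiv.ofBijective (f.app x) (hf x)
  have he : ∀ x a, f.app x ((e x).symm a) = a := fun x a => (e x).apply_symm_apply a
  have he' : ∀ x a, (e x).symm (f.app x a) = a := fun x a => (e x).symm_apply_apply a
  let g : F ⟶ E :=
    { app := fun x => (e x).symm.toLinearMap
      continuous_map := by
        refine ⟨fun U hU => ?_⟩
        -- The preimage of U under the inverse is the image of U under f, so openness of f gives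
        -- continuity of the inverse.
        convert (Hom.isLocalHomeomorph_etale f).isOpenMap U hU using 1
        ext ⟨x, b⟩
        constructor
        · intro h
          exact ⟨_, h, congrArg (Etale.mk x) (he x b)⟩
        · rintro ⟨⟨y, a⟩, ha, h⟩
          obtain rfl : y = x := congrArg Etale.base h
          obtain rfl : f.app y a = b := by simpa [Hom.etale] using h
          exact (congrArg (fun t => (⟨y, t⟩ : Etale E.stalk) ∈ U) (he' y a)).mpr ha
      equivariant := fun k x y h a => by
        refine (hf y).injective ((he y _).trans ?_)
        exact ((f.equivariant k h _).trans (congrArg (F.act k h) (he x a))).symm }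
  exact ⟨g, hom_ext fun x a => he' x a, hom_ext fun x a => he x a⟩

theorem bijective_of_isIso {E F : EqSheaf G X R} (f : E ⟶ F) [IsIso f] (x : X) :
    Function.Bijective (f.app x) := by
  refine Function.bijective_iff_has_inverse.2 ⟨(inv f).app x, fun a => ?_, fun a => ?_⟩
  · exact congrArg (fun k : E ⟶ E => k.app x a) (IsIso.hom_inv_id f)
  · exact congrArg (fun k : F ⟶ F => k.app x a) (IsIso.inv_hom_id f)

/-- Taking the stalk at `x`. -/
def stalkFunctor (G : Type u) {X : Type u} [Group G] [TopologicalSpace G] [TopologicalSpace X]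
    [MulAction G X] (R : Type w) [Ring R] (x : X) : EqSheaf G X R ⥤ ModuleCat.{u} R where
  obj E := ModuleCat.of R (E.stalk x)
  map f := ModuleCat.ofHom (f.app x)

/-- This gives access to elements of a filtered colimit of modules: representatives at some stage,
and equality at a later one. -/
theorem preservesColimitsOfShape_forget_moduleCat (J : Type u) [SmallCategory J] [IsFiltered J]
    (R : Type w) [Ring R] : Limits.PreservesColimitsOfShape J (forget (ModuleCat.{u} R)) :=
  inferInstanceAs (Limits.PreservesColimitsOfShape J
    (forget₂ (ModuleCat.{u} R) AddCommGrpCat ⋙ forget AddCommGrpCat.{u}))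

/-! ### Filtered colimits of equivariant sheaves -/

variable {J : Type u} [SmallCategory J] (F : J ⥤ EqSheaf G X R)

/-- The stalks of the colimit of a diagram of sheaves. -/
def colimStalk (x : X) : Type u :=
  (Limits.colimit (F ⋙ stalkFunctor G R x) : ModuleCat.{u} R)

noncomputable instance (x : X) : AddCommGroup (colimStalk F x) :=
  inferInstanceAs (AddCommGroup (Limits.colimit (F ⋙ stalkFunctor G R x) : ModuleCat.{u} R))

noncomputable instance (x : X) : Module R (colimStalk F x) :=
  inferInstanceAs (Module R (Limits.colimit (F ⋙ stalkFunctor G R x) : ModuleCat.{u} R))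

/-- The maps from the stalks of a diagram of sheaves to their colimit. -/
noncomputable def colimIncl (j : J) (x : X) : (F.obj j).stalk x →ₗ[R] colimStalk F x :=
  (Limits.colimit.ι (F ⋙ stalkFunctor G R x) j).hom

theorem colimIncl_map {j k : J} (f : j ⟶ k) (x : X) (a : (F.obj j).stalk x) :
    colimIncl F k x ((F.map f).app x a) = colimIncl F j x a :=
  congrArg (fun t => t.hom a) (Limits.colimit.w (F ⋙ stalkFunctor G R x) f)

/-- A compatible family of linear maps on the stalks of a diagram, as a cocone. -/
def colimLiftCocone {x : X} {M : Type u} [AddCommGroup M] [Module R M]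
    (φ : ∀ j, (F.obj j).stalk x →ₗ[R] M)
    (hφ : ∀ (j k) (f : j ⟶ k) a, φ k ((F.map f).app x a) = φ j a) :
    Limits.Cocone (F ⋙ stalkFunctor G R x) where
  pt := ModuleCat.of R M
  ι :=
    { app := fun j => ModuleCat.ofHom (φ j)
      naturality := fun j k f => by
        ext a
        exact hφ j k f a }

/-- A compatible family of linear maps on the stalks of a diagram induces one on the colimit. -/
noncomputable def colimLift {x : X} {M : Type u} [AddCommGroup M] [Module R M]
    (φ : ∀ j, (F.obj j).stalk x →ₗ[R] M)
    (hφ : ∀ (j k) (f : j ⟶ k) a, φ k ((F.map f).app x a) = φ j a) : colimStalk F x →ₗ[R] M :=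
  (Limits.colimit.desc (F ⋙ stalkFunctor G R x) (colimLiftCocone F φ hφ)).hom

@[simp]
theorem colimLift_incl {x : X} {M : Type u} [AddCommGroup M] [Module R M]
    (φ : ∀ j, (F.obj j).stalk x →ₗ[R] M)
    (hφ : ∀ (j k) (f : j ⟶ k) a, φ k ((F.map f).app x a) = φ j a) (j : J)
    (a : (F.obj j).stalk x) : colimLift F φ hφ (colimIncl F j x a) = φ j a :=
  congrArg (fun t => t.hom a) (Limits.colimit.ι_desc (colimLiftCocone F φ hφ) j)

/-- The maps from the sheaf spaces of a diagram to the sheaf space of the colimit. -/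
noncomputable def colimEtale (j : J) (e : Etale (F.obj j).stalk) : Etale (colimStalk F) :=
  ⟨e.base, colimIncl F j e.base e.val⟩

/-- With the final topology, continuity of maps out of the colimit is checked on the stages. That
the result is still a sheaf space rests on the openness of the maps `colimEtale`. -/
noncomputable instance : TopologicalSpace (Etale (colimStalk F)) :=
  ⨆ j, TopologicalSpace.coinduced (colimEtale F j) inferInstance

theorem colimAct_compat (g : G) {x y : X} (h : g • x = y) (j k : J) (f : j ⟶ k)
    (a : (F.obj j).stalk x) :
    colimIncl F k y ((F.obj k).act g h ((F.map f).app x a)) =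
      colimIncl F j y ((F.obj j).act g h a) :=
  (congrArg (colimIncl F k y) ((F.map f).equivariant g h a).symm).trans (colimIncl_map F f y _)

/-- The action on the stalks of the colimit. -/
noncomputable def colimAct (g : G) {x y : X} (h : g • x = y) :
    colimStalk F x →ₗ[R] colimStalk F y :=
  colimLift F (fun j => (colimIncl F j y).comp ((F.obj j).act g h)) (colimAct_compat F g h)

@[simp]
theorem colimAct_incl (g : G) {x y : X} (h : g • x = y) (j : J) (a : (F.obj j).stalk x) :
    colimAct F g h (colimIncl F j x a) = colimIncl F j y ((F.obj j).act g h a) :=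
  colimLift_incl F _ (colimAct_compat F g h) j a

theorem isOpen_colimStalk_iff {U : Set (Etale (colimStalk F))} :
    IsOpen U ↔ ∀ j, IsOpen (colimEtale F j ⁻¹' U) := by
  rw [isOpen_iSup_iff]
  rfl

theorem continuous_colimEtale (j : J) : Continuous (colimEtale F j) :=
  ⟨fun _ hU => (isOpen_colimStalk_iff F).1 hU j⟩

theorem continuous_colimStalk_dom {T : Type*} [TopologicalSpace T] {f : Etale (colimStalk F) → T}
    (hf : ∀ j, Continuous (f ∘ colimEtale F j)) : Continuous f :=
  ⟨fun _ hU => (isOpen_colimStalk_iff F).2 fun j => hU.preimage (hf j)⟩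

theorem continuous_base_colimStalk : Continuous (Etale.base : Etale (colimStalk F) → X) :=
  continuous_colimStalk_dom F fun j => (F.obj j).isLocalHomeomorph.continuous

theorem cocone_app_compat (s : Limits.Cocone F) (x : X) (j k : J) (f : j ⟶ k)
    (a : (F.obj j).stalk x) :
    (s.ι.app k).app x ((F.map f).app x a) = (s.ι.app j).app x a :=
  congrArg (fun t => Hom.app t x a) (s.w f)

variable [IsFiltered J]

theorem exists_colimIncl {x : X} (a : colimStalk F x) : ∃ j b, colimIncl F j x b = a := by
  have := preservesColimitsOfShape_forget_moduleCat J R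
  exact Limits.Concrete.colimit_exists_rep (F ⋙ stalkFunctor G R x) a

theorem colimIncl_eq_iff {x : X} {i j : J} (a : (F.obj i).stalk x) (b : (F.obj j).stalk x) :
    colimIncl F i x a = colimIncl F j x b ↔
      ∃ (k : J) (f : i ⟶ k) (g : j ⟶ k), (F.map f).app x a = (F.map g).app x b := by
  have := preservesColimitsOfShape_forget_moduleCat J R
  exact Limits.Concrete.colimit_rep_eq_iff_exists (F ⋙ stalkFunctor G R x) a b

/-- A germ at stage k has the same image as a germ in V exactly when the two agree at a later stage
l. The preimage at stage k is thus a union of sets g⁻¹(f(V)), and these are open since transition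
maps are continuous and open. -/
theorem isOpenMap_colimEtale (j : J) : IsOpenMap (colimEtale F j) := by
  intro V hV
  refine (isOpen_colimStalk_iff F).2 fun k => isOpen_iff_forall_mem_open.2 ?_
  rintro ⟨x, b⟩ ⟨⟨y, a⟩, ha, h⟩
  obtain rfl : y = x := congrArg Etale.base h
  have h' : colimIncl F j y a = colimIncl F k y b := by simpa [colimEtale] using h
  obtain ⟨l, f, g, hfg⟩ := (colimIncl_eq_iff F a b).1 h'
  refine ⟨Hom.etale (F.map g) ⁻¹' (Hom.etale (F.map f) '' V), ?_,
    ((Hom.isLocalHomeomorph_etale (F.map f)).isOpenMap V hV).preimage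
      (Hom.continuous_etale (F.map g)), ⟨_, ha, congrArg (Etale.mk y) hfg⟩⟩
  rintro ⟨z, c⟩ ⟨⟨z', d⟩, hd, hcd⟩
  obtain rfl : z' = z := congrArg Etale.base hcd
  have hcd' : (F.map f).app z' d = (F.map g).app z' c := by simpa [Hom.etale] using hcd
  refine ⟨_, hd, congrArg (Etale.mk z') ?_⟩
  exact (colimIncl_eq_iff F d c).2 ⟨l, f, g, hcd'⟩

theorem exists_colimEtale (e : Etale (colimStalk F)) : ∃ j d, colimEtale F j d = e := by
  obtain ⟨x, a⟩ := e
  obtain ⟨j, b, rfl⟩ := exists_colimIncl F a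
  exact ⟨j, ⟨x, b⟩, rfl⟩

theorem exists_colimIncl₂ {x : X} (a b : colimStalk F x) :
    ∃ j a' b', colimIncl F j x a' = a ∧ colimIncl F j x b' = b := by
  obtain ⟨i, a, rfl⟩ := exists_colimIncl F a
  obtain ⟨j, b, rfl⟩ := exists_colimIncl F b
  exact ⟨IsFiltered.max i j, _, _, colimIncl_map F (IsFiltered.leftToMax i j) x a,
    colimIncl_map F (IsFiltered.rightToMax i j) x b⟩

theorem isLocalHomeomorph_base_colimStalk :
    IsLocalHomeomorph (Etale.base : Etale (colimStalk F) → X) := by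
  refine isLocalHomeomorph_of_isOpenMap (continuous_base_colimStalk F) (fun U hU => ?_)
    fun e => ?_
  · have h : Etale.base '' U = ⋃ j, Etale.base '' (colimEtale F j ⁻¹' U) := by
      ext x
      simp only [Set.mem_image, Set.mem_iUnion, Set.mem_preimage]
      constructor
      · rintro ⟨e, he, rfl⟩
        obtain ⟨j, d, rfl⟩ := exists_colimEtale F e
        exact ⟨j, d, he, rfl⟩
      · rintro ⟨j, d, hd, rfl⟩
        exact ⟨_, hd, rfl⟩
    rw [h]
    exact isOpen_iUnion fun j => (F.obj j).isLocalHomeomorph.isOpenMap _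
      (hU.preimage (continuous_colimEtale F j))
  · obtain ⟨j, d, rfl⟩ := exists_colimEtale F e
    obtain ⟨U, hU, hd, hi⟩ := (F.obj j).isLocalHomeomorph.exists_injOn d
    refine ⟨_, isOpenMap_colimEtale F j U hU, ⟨d, hd, rfl⟩, ?_⟩
    rintro _ ⟨a, ha, rfl⟩ _ ⟨b, hb, rfl⟩ h
    exact congrArg (colimEtale F j) (hi ha hb h)

/-- The colimit of a filtered diagram of sheaves. -/
noncomputable def filteredColimit : EqSheaf G X R where
  stalk := colimStalk F
  isLocalHomeomorph := isLocalHomeomorph_base_colimStalk F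
  continuous_sub := by
    let _ : TopologicalSpace (Etale fun x => colimStalk F x × colimStalk F x) :=
      TopologicalSpace.induced
        (fun q => ((⟨q.base, q.val.1⟩, ⟨q.base, q.val.2⟩) :
          Etale (colimStalk F) × Etale (colimStalk F))) inferInstance
    have hd : Continuous (fun q : (Etale fun x => colimStalk F x × colimStalk F x) =>
        ((⟨q.base, q.val.1⟩, ⟨q.base, q.val.2⟩) :
          Etale (colimStalk F) × Etale (colimStalk F))) := continuous_induced_dom
    refine ⟨fun W hW => isOpen_iff_forall_mem_open.2 ?_⟩
    rintro ⟨x, a, b⟩ hab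
    -- Once both germs live at one stage j, continuity of subtraction there gives a box A × B; its
    -- image in the colimit is a neighbourhood because `colimEtale F j` is open.
    obtain ⟨j, a, b, rfl, rfl⟩ := exists_colimIncl₂ F a b
    let _ : TopologicalSpace (Etale fun x => (F.obj j).stalk x × (F.obj j).stalk x) :=
      TopologicalSpace.induced
        (fun q => ((⟨q.base, q.val.1⟩, ⟨q.base, q.val.2⟩) :
          Etale (F.obj j).stalk × Etale (F.obj j).stalk)) inferInstance
    obtain ⟨V, hV, hVW⟩ := isOpen_induced_iff.1
      ((hW.preimage (continuous_colimEtale F j)).preimage (F.obj j).continuous_sub)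
    have hmem : ∀ (y : X) (c d : (F.obj j).stalk y),
        ((⟨y, c⟩, ⟨y, d⟩) : Etale (F.obj j).stalk × Etale (F.obj j).stalk) ∈ V ↔
          (⟨y, colimIncl F j y c - colimIncl F j y d⟩ : Etale (colimStalk F)) ∈ W := by
      intro y c d
      have h := Set.ext_iff.1 hVW ⟨y, c, d⟩
      rw [← map_sub]
      exact h
    obtain ⟨A, B, hA, hB, h1, h2, hAB⟩ := isOpen_prod_iff.1 hV _ _ ((hmem x a b).2 hab)
    refine ⟨_, ?_, ((isOpenMap_colimEtale F j A hA).prod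
      (isOpenMap_colimEtale F j B hB)).preimage hd, ⟨⟨_, h1, rfl⟩, ⟨_, h2, rfl⟩⟩⟩
    rintro ⟨y, c, d⟩ ⟨⟨⟨y1, c'⟩, hc', hc⟩, ⟨⟨y2, d'⟩, hd', hd⟩⟩
    obtain rfl : y1 = y := congrArg Etale.base hc
    obtain rfl : y2 = y1 := congrArg Etale.base hd
    obtain rfl : colimIncl F j y2 c' = c := by simpa [colimEtale] using hc
    obtain rfl : colimIncl F j y2 d' = d := by simpa [colimEtale] using hd
    exact (hmem _ _ _).1 (hAB ⟨hc', hd'⟩)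
  continuous_smul r := continuous_colimStalk_dom F fun j => by
    refine ((continuous_colimEtale F j).comp ((F.obj j).continuous_smul r)).congr fun e => ?_
    exact congrArg (Etale.mk e.base) (map_smul (colimIncl F j e.base) r e.val)
  act := colimAct F
  act_one x a := by
    obtain ⟨j, a, rfl⟩ := exists_colimIncl F a
    simp [(F.obj j).act_one]
  act_mul g h x y z hxy hyz hxz a := by
    obtain ⟨j, a, rfl⟩ := exists_colimIncl F a
    simp [(F.obj j).act_mul g h hxy hyz hxz]
  continuous_act := by
    refine continuous_iff_continuousAt.2 ?_
    rintro ⟨g, e⟩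
    obtain ⟨j, d, rfl⟩ := exists_colimEtale F e
    -- An open map carries neighbourhoods to neighbourhoods, so continuity at the image point can be
    -- checked at stage j.
    have ho : IsOpenMap (Prod.map (id : G → G) (colimEtale F j)) :=
      IsOpenMap.id.prodMap (isOpenMap_colimEtale F j)
    refine Filter.Tendsto.mono_left ?_ (ho.nhds_le (g, d))
    refine Filter.tendsto_map'_iff.2 (Continuous.tendsto ?_ (g, d))
    refine ((continuous_colimEtale F j).comp (F.obj j).continuous_act).congr fun q => ?_
    exact congrArg (Etale.mk _) (colimAct_incl F q.1 rfl j q.2.val).symm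

/-- The cocone under a filtered diagram given by its colimit. -/
noncomputable def filteredCocone : Limits.Cocone F where
  pt := filteredColimit F
  ι :=
    { app := fun j =>
        { app := colimIncl F j
          continuous_map := continuous_colimEtale F j
          equivariant := fun g _ _ h a => (colimAct_incl F g h j a).symm }
      naturality := fun _ _ f => hom_ext fun x a => colimIncl_map F f x a }

/-- The map from the filtered colimit to the vertex of a cocone. -/
noncomputable def filteredColimitDesc (s : Limits.Cocone F) : filteredColimit F ⟶ s.pt where
  app x := colimLift F (M := s.pt.stalk x) (fun j => (s.ι.app j).app x) (cocone_app_compat F s x)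
  continuous_map := continuous_colimStalk_dom F fun j =>
    (s.ι.app j).continuous_map.congr fun e =>
      congrArg (Etale.mk e.base)
        (colimLift_incl F (M := s.pt.stalk e.base) _ (cocone_app_compat F s e.base) j e.val).symm
  equivariant g x y h a := by
    obtain ⟨j, a, rfl⟩ := exists_colimIncl F a
    have h1 := colimLift_incl F (M := s.pt.stalk y) _ (cocone_app_compat F s y) j
      ((F.obj j).act g h a)
    have h2 := colimLift_incl F (M := s.pt.stalk x) _ (cocone_app_compat F s x) j a
    refine (congrArg _ (colimAct_incl F g h j a)).trans (h1.trans ?_)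
    exact ((s.ι.app j).equivariant g h a).trans (congrArg (s.pt.act g h) h2.symm)

/-- The cocone `filteredCocone` is a colimit cocone. -/
noncomputable def isColimitFilteredCocone : Limits.IsColimit (filteredCocone F) where
  desc s := filteredColimitDesc F s
  fac s j := hom_ext fun x a =>
    colimLift_incl F (M := s.pt.stalk x) _ (cocone_app_compat F s x) j a
  uniq s m hm := hom_ext fun x a => by
    obtain ⟨j, a, rfl⟩ := exists_colimIncl F a
    refine (congrArg (fun t => Hom.app t x a) (hm j)).trans ?_
    exact (colimLift_incl F (M := s.pt.stalk x) _ (cocone_app_compat F s x) j a).symm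

theorem hasColimitsOfShape_of_isFiltered :
    Limits.HasColimitsOfShape J (EqSheaf G X R) :=
  ⟨fun F => ⟨⟨⟨filteredCocone F, isColimitFilteredCocone F⟩⟩⟩⟩

variable {F}

/-- Stated for an arbitrary colimit cocone, so that it applies to the chosen `Limits.colimit`; the
explicit construction is not needed afterwards. -/
theorem exists_rep_of_isColimit {c : Limits.Cocone F} (hc : Limits.IsColimit c) {x : X}
    (a : c.pt.stalk x) : ∃ j b, (c.ι.app j).app x b = a := by
  let e := (isColimitFilteredCocone F).coconePointUniqueUpToIso hc
  obtain ⟨a, rfl⟩ := (bijective_of_isIso e.hom x).surjective a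
  obtain ⟨j, b, rfl⟩ := exists_colimIncl F a
  exact ⟨j, b, congrArg (fun t => Hom.app t x b)
    ((isColimitFilteredCocone F).comp_coconePointUniqueUpToIso_hom hc j).symm⟩

theorem ι_app_eq_iff_of_isColimit {c : Limits.Cocone F} (hc : Limits.IsColimit c) {x : X}
    {i j : J} (a : (F.obj i).stalk x) (b : (F.obj j).stalk x) :
    (c.ι.app i).app x a = (c.ι.app j).app x b ↔
      ∃ (k : J) (f : i ⟶ k) (g : j ⟶ k), (F.map f).app x a = (F.map g).app x b := by
  rw [← colimIncl_eq_iff]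
  let e := (isColimitFilteredCocone F).coconePointUniqueUpToIso hc
  have h : ∀ (i : J) (a : (F.obj i).stalk x),
      e.hom.app x (colimIncl F i x a) = (c.ι.app i).app x a := fun i a =>
    congrArg (fun t => Hom.app t x a)
      ((isColimitFilteredCocone F).comp_coconePointUniqueUpToIso_hom hc i)
  rw [← h, ← h]
  exact (bijective_of_isIso e.hom x).injective.eq_iff

end EqSheaf

/-! ### The topology of the space of closed subgroups -/

namespace SubgroupSpace

variable {G : Type u} [Group G] [TopologicalSpace G] [IsTopologicalGroup G]

instance : Nonempty (OpenNormalSubgroup G) :=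
  ⟨{ (⊤ : OpenSubgroup G) with isNormal' := (inferInstance : (⊤ : Subgroup G).Normal) }⟩

theorem mem_basicOpen_iff {N : OpenNormalSubgroup G} {K L : SubgroupSpace G} :
    L ∈ basicOpen N K ↔ (projMap N).base L = (projMap N).base K :=
  ⟨fun h => SubgroupSpace.ext h, fun h => congrArg toSubgroup h⟩

theorem projMap_base_eq_of_le {M N : OpenNormalSubgroup G} (h : M ≤ N) {K L : SubgroupSpace G}
    (hKL : (projMap M).base K = (projMap M).base L) :
    (projMap N).base K = (projMap N).base L := by
  rw [transMap_projMap h, transMap_projMap h, hKL]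

/-- The generating sets form a base: they are fibres of the p_N, and a fibre of p_{M ⊓ N} lies in a
fibre of p_M and in one of p_N. -/
theorem exists_basicOpen_subset {U : Set (SubgroupSpace G)} (hU : IsOpen U) {K : SubgroupSpace G}
    (hK : K ∈ U) : ∃ N, basicOpen N K ⊆ U := by
  induction hU with
  | basic U h =>
    obtain ⟨N, K', rfl⟩ := h
    refine ⟨N, fun L hL => ?_⟩
    rw [mem_basicOpen_iff] at *
    exact hL.trans hK
  | univ => exact ⟨Classical.arbitrary _, Set.subset_univ _⟩
  | inter U V _ _ hU hV =>
    obtain ⟨M, hM⟩ := hU hK.1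
    obtain ⟨N, hN⟩ := hV hK.2
    refine ⟨M ⊓ N, fun L hL => ⟨hM ?_, hN ?_⟩⟩
    · rw [mem_basicOpen_iff] at *
      exact projMap_base_eq_of_le inf_le_left hL
    · rw [mem_basicOpen_iff] at *
      exact projMap_base_eq_of_le inf_le_right hL
  | sUnion S _ h =>
    obtain ⟨U, hU, hKU⟩ := hK
    obtain ⟨N, hN⟩ := h U hU hKU
    exact ⟨N, hN.trans (Set.subset_sUnion_of_mem hU)⟩

theorem isOpen_fibre (N : OpenNormalSubgroup G) (y : SubgroupSpace (G ⧸ N.toSubgroup)) :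
    IsOpen {K | (projMap N).base K = y} :=
  (isOpen_discrete {y}).preimage (projMap N).continuous_base

theorem isClosed_fibre (N : OpenNormalSubgroup G) (y : SubgroupSpace (G ⧸ N.toSubgroup)) :
    IsClosed {K | (projMap N).base K = y} :=
  (isClosed_discrete {y}).preimage (projMap N).continuous_base

theorem projMap_base_surjective (N : OpenNormalSubgroup G) :
    Function.Surjective (projMap N).base := by
  intro y
  refine ⟨{ y.toSubgroup.comap (QuotientGroup.mk' N.toSubgroup) with
    isClosed' := (isClosed_discrete (y.toSubgroup : Set (G ⧸ N.toSubgroup))).preimage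
      QuotientGroup.continuous_mk }, SubgroupSpace.ext ?_⟩
  exact Subgroup.map_comap_eq_self_of_surjective (QuotientGroup.mk'_surjective _) y.toSubgroup

/-- The limit of an ultrafilter of closed subgroups. -/
def ultrafilterLim (f : Ultrafilter (SubgroupSpace G)) : SubgroupSpace G where
  carrier := {g | ∀ N : OpenNormalSubgroup G, ∀ᶠ L : SubgroupSpace G in f,
    (QuotientGroup.mk' N.toSubgroup g) ∈ L.toSubgroup.map (QuotientGroup.mk' N.toSubgroup)}
  one_mem' N := Filter.Eventually.of_forall fun L => by
    rw [map_one]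
    exact Subgroup.one_mem _
  mul_mem' ha hb N := by
    filter_upwards [ha N, hb N] with L h1 h2
    rw [map_mul]
    exact Subgroup.mul_mem _ h1 h2
  inv_mem' ha N := by
    filter_upwards [ha N] with L h1
    rw [map_inv]
    exact Subgroup.inv_mem _ h1
  isClosed' := by
    -- For a fixed N the condition on g depends only on its class in the discrete group G/N.
    have h : ∀ N : OpenNormalSubgroup G, IsClosed {g : G | ∀ᶠ L : SubgroupSpace G in f,
        (QuotientGroup.mk' N.toSubgroup g) ∈
          L.toSubgroup.map (QuotientGroup.mk' N.toSubgroup)} := fun N =>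
      (isClosed_discrete {q : G ⧸ N.toSubgroup | ∀ᶠ L : SubgroupSpace G in f,
        q ∈ L.toSubgroup.map (QuotientGroup.mk' N.toSubgroup)}).preimage
        QuotientGroup.continuous_mk
    convert isClosed_iInter h using 1
    ext g
    simp only [Set.mem_iInter]
    rfl

theorem mem_ultrafilterLim {f : Ultrafilter (SubgroupSpace G)} {g : G} :
    g ∈ (ultrafilterLim f).toSubgroup ↔ ∀ N : OpenNormalSubgroup G,
      ∀ᶠ L : SubgroupSpace G in f,
        (QuotientGroup.mk' N.toSubgroup g) ∈ L.toSubgroup.map (QuotientGroup.mk' N.toSubgroup) :=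
  Iff.rfl

variable [CompactSpace G]

/-- This is convergence of the ultrafilter to `ultrafilterLim f`, tested on basic neighbourhoods.
Compactness of G enters twice: G/N is finite, and lifts of an element of G/N have a limit in G. -/
theorem map_ultrafilterLim (f : Ultrafilter (SubgroupSpace G)) (N : OpenNormalSubgroup G) :
    ∀ᶠ L : SubgroupSpace G in f, L.toSubgroup.map (QuotientGroup.mk' N.toSubgroup) =
      (ultrafilterLim f).toSubgroup.map (QuotientGroup.mk' N.toSubgroup) := by
  have : Finite (G ⧸ N.toSubgroup) := Subgroup.quotient_finite_of_isOpen _ N.isOpen'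
  -- G/N has finitely many subgroups, so almost all L have the same image H.
  obtain ⟨H, hH⟩ := Ultrafilter.eq_pure_of_finite
    (f.map fun L : SubgroupSpace G => L.toSubgroup.map (QuotientGroup.mk' N.toSubgroup))
  have hf : ∀ᶠ L : SubgroupSpace G in f,
      L.toSubgroup.map (QuotientGroup.mk' N.toSubgroup) = H := by
    have h : {H} ∈ f.map fun L : SubgroupSpace G =>
        L.toSubgroup.map (QuotientGroup.mk' N.toSubgroup) := by
      rw [hH]
      exact Ultrafilter.mem_pure.2 rfl
    exact h
  have hHK : H = (ultrafilterLim f).toSubgroup.map (QuotientGroup.mk' N.toSubgroup) := by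
    ext q
    constructor
    · intro hq
      -- Choose a lift of q in each L whose image contains q; the value 1 elsewhere is irrelevant,
      -- since almost every L qualifies.
      have h1 : ∀ L : SubgroupSpace G, ∃ k : G,
          q ∈ L.toSubgroup.map (QuotientGroup.mk' N.toSubgroup) →
            k ∈ L.toSubgroup ∧ QuotientGroup.mk' N.toSubgroup k = q := by
        intro L
        by_cases h : q ∈ L.toSubgroup.map (QuotientGroup.mk' N.toSubgroup)
        · obtain ⟨k, hk, hkq⟩ := h
          exact ⟨k, fun _ => ⟨hk, hkq⟩⟩
        · exact ⟨1, fun h' => absurd h' h⟩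
      choose k hk using h1
      have h2 : ∀ᶠ L : SubgroupSpace G in f,
          k L ∈ L.toSubgroup ∧ QuotientGroup.mk' N.toSubgroup (k L) = q := by
        filter_upwards [hf] with L hL
        exact hk L (hL ▸ hq)
      -- The limit g of the lifts is congruent to almost all k L modulo every M. Hence g lies in the
      -- limit subgroup, and modulo N it is q.
      obtain ⟨g, -, hg⟩ := isCompact_iff_ultrafilter_le_nhds.1 isCompact_univ (f.map k) (by simp)
      have hg' : ∀ (M : OpenNormalSubgroup G), ∀ᶠ L : SubgroupSpace G in f,
          QuotientGroup.mk' M.toSubgroup (k L) = QuotientGroup.mk' M.toSubgroup g := by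
        intro M
        have hc : Continuous (QuotientGroup.mk' M.toSubgroup) := QuotientGroup.continuous_mk
        exact hg (((isOpen_discrete {QuotientGroup.mk' M.toSubgroup g}).preimage hc).mem_nhds rfl)
      refine ⟨g, fun M => ?_, ?_⟩
      · filter_upwards [h2, hg' M] with L h3 h4
        exact ⟨k L, h3.1, h4⟩
      · obtain ⟨L, h3, h4⟩ := (h2.and (hg' N)).exists
        exact h4.symm.trans h3.2
    · rintro ⟨g, hg, rfl⟩
      obtain ⟨L, h3, h4⟩ := ((mem_ultrafilterLim.1 hg N).and hf).exists
      exact h4 ▸ h3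
  rwa [hHK] at hf

instance : CompactSpace (SubgroupSpace G) := by
  refine ⟨isCompact_iff_ultrafilter_le_nhds.2 fun f _ =>
    ⟨ultrafilterLim f, Set.mem_univ _, fun U hU => ?_⟩⟩
  obtain ⟨V, hVU, hV, hK⟩ := mem_nhds_iff.1 hU
  obtain ⟨N, hN⟩ := exists_basicOpen_subset hV hK
  exact Filter.mem_of_superset (map_ultrafilterLim f N) (hN.trans hVU)

/-- A property of pairs `(N, K)` that is stable under shrinking `N` and holds locally on `S G` for
some `N` holds on each fibre for a common `N`. -/
theorem exists_uniform {N : OpenNormalSubgroup G} (y : SubgroupSpace (G ⧸ N.toSubgroup))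
    (P : ∀ M : OpenNormalSubgroup G, SubgroupSpace (G ⧸ M.toSubgroup) → Prop)
    (hP : ∀ {L M : OpenNormalSubgroup G} (_ : L ≤ M) (K : SubgroupSpace G),
      P M ((projMap M).base K) → P L ((projMap L).base K))
    (h : ∀ K, (projMap N).base K = y → ∃ M, P M ((projMap M).base K)) :
    ∃ M, M ≤ N ∧ ∀ K, (projMap N).base K = y → P M ((projMap M).base K) := by
  have key : ∃ M, ∀ K ∈ {K | (projMap N).base K = y}, P M ((projMap M).base K) := by
    refine (isClosed_fibre N y).isCompact.induction_on
      (p := fun s => ∃ M, ∀ K ∈ s, P M ((projMap M).base K)) ?_ ?_ ?_ ?_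
    · exact ⟨Classical.arbitrary _, fun _ h => h.elim⟩
    · exact fun s t hst ⟨M, hM⟩ => ⟨M, fun K hK => hM K (hst hK)⟩
    · rintro s t ⟨M, hM⟩ ⟨M', hM'⟩
      refine ⟨M ⊓ M', fun K hK => ?_⟩
      rcases hK with hK | hK
      · exact hP inf_le_left K (hM K hK)
      · exact hP inf_le_right K (hM' K hK)
    · intro K hK
      obtain ⟨M, hM⟩ := h K hK
      -- P M sees K only through p_M K, so it holds on the whole basic neighbourhood of K.
      refine ⟨_, mem_nhdsWithin_of_mem_nhds ((isOpen_basicOpen M K).mem_nhds rfl), M,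
        fun L hL => ?_⟩
      rw [mem_basicOpen_iff.1 hL]
      exact hM
  obtain ⟨M, hM⟩ := key
  exact ⟨M ⊓ N, inf_le_right, fun K hK => hP inf_le_left K (hM K hK)⟩

end SubgroupSpace

instance {G : Type u} [Group G] [TopologicalSpace G] [IsTopologicalGroup G] :
    IsFiltered (OpenNormalSubgroup G)ᵒᵖ :=
  have : IsCofiltered (OpenNormalSubgroup G) := isCofiltered_of_semilatticeInf_nonempty _
  inferInstance

/-! ### Evaluation and extension of sections, and the counit -/

namespace EqSheaf

section

variable {G X H Y : Type u} [Group G] [TopologicalSpace G] [TopologicalSpace X] [MulAction G X]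
  [Group H] [TopologicalSpace H] [TopologicalSpace Y] [MulAction H Y] {R : Type w} [Ring R]

theorem sections_ext {p : SpaceMap G X H Y} {E : EqSheaf G X R} {y : Y}
    {s t : fixedSections p E y} (h : ∀ x (hx : p.base x = y), s.1 ⟨x, hx⟩ = t.1 ⟨x, hx⟩) :
    s = t :=
  Subtype.ext (funext fun x => h x.1 x.2)

variable [ContinuousSMul G X] [DiscreteTopology H] [DiscreteTopology Y]

/-- The evaluation map `p̄^* p̄_* E → E`, `(x, s) ↦ s x`. -/
noncomputable def evalSections (p : SpaceMap G X H Y) (hp : Function.Surjective p.hom)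
    (E : EqSheaf G X R) : (pullback R p).obj ((pushforward R p hp).obj E) ⟶ E where
  app x :=
    { toFun := fun s : fixedSections p E (p.base x) => s.1 ⟨x, rfl⟩
      map_add' := fun _ _ => rfl
      map_smul' := fun _ _ => rfl }
  continuous_map := by
    have hd := discreteTopology_etale ((pushforward R p hp).obj E)
    have hc : @Continuous _ _ ((pullback R p).obj ((pushforward R p hp).obj E)).topology _
        (pullbackMap p ((pushforward R p hp).obj E)) := continuous_induced_dom
    refine ⟨fun W hW => isOpen_iff_forall_mem_open.2 ?_⟩
    rintro ⟨x, s⟩ hs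
    -- The pushforward has a discrete sheaf space, so near (x, s) the section s can be held fixed;
    -- what remains is the continuity of s itself.
    obtain ⟨O, hO, hOW⟩ := isOpen_induced_iff.1 (hW.preimage (s : fixedSections p E (p.base x)).2.1)
    refine ⟨pullbackMap p ((pushforward R p hp).obj E) ⁻¹'
        (O ×ˢ ({⟨p.base x, s⟩} : Set (Etale ((pushforward R p hp).obj E).stalk))), ?_,
      (hO.prod (isOpen_discrete _)).preimage hc, ⟨?_, rfl⟩⟩
    · rintro ⟨x', s'⟩ ⟨hx', hs'⟩
      have key : ∀ {y : Y} (hy : p.base x' = y) (s' : fixedSections p E (p.base x'))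
          (s : fixedSections p E y)
          (_ : (⟨p.base x', s'⟩ : Etale fun y => fixedSections p E y) = ⟨y, s⟩),
          s'.1 ⟨x', rfl⟩ = s.1 ⟨x', hy⟩ := by
        rintro _ rfl s' s h
        simp only [Etale.mk.injEq, heq_eq_eq, true_and] at h
        rw [h]
      have hb : p.base x' = p.base x := congrArg Etale.base hs'
      have h1 := key hb s' s hs'
      have h2 := (Set.ext_iff.1 hOW ⟨x', hb⟩).1 hx'
      exact (congrArg (fun t => (⟨x', t⟩ : Etale E.stalk) ∈ W) h1).mpr h2
    · exact (Set.ext_iff.1 hOW ⟨x, rfl⟩).2 hs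
  equivariant g x x' h s := translate_apply p E (k := g)
    (Function.surjInv_eq hp _).symm
    (by rw [Function.surjInv_eq hp, ← p.base_smul, h]) s rfl rfl h

theorem transport_sections_apply (p : SpaceMap G X H Y) (hp : Function.Surjective p.hom)
    (E : EqSheaf G X R) {y y' : Y} (h : y = y') (s : fixedSections p E y) (x : X)
    (hx : p.base x = y') :
    (((pushforward R p hp).obj E).transport h s : fixedSections p E y').1 ⟨x, hx⟩ =
      s.1 ⟨x, hx.trans h.symm⟩ := by
  subst h
  exact congrArg (fun t : fixedSections p E y => t.1 ⟨x, hx⟩)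
    (transport_rfl ((pushforward R p hp).obj E) s)

end

section

variable {G X : Type u} [Group G] [TopologicalSpace G] [TopologicalSpace X] [MulAction G X]
  {R : Type w} [Ring R]

/-- Two continuous families of germs over the same points agree on an open set. -/
theorem isOpen_setOf_eq (E : EqSheaf G X R) {T : Type*} [TopologicalSpace T] {b : T → X}
    {s t : ∀ i, E.stalk (b i)} (hs : Continuous fun i => (⟨b i, s i⟩ : Etale E.stalk))
    (ht : Continuous fun i => (⟨b i, t i⟩ : Etale E.stalk)) : IsOpen {i | s i = t i} := by
  convert E.isLocalHomeomorph.isLocallyInjective.isOpen_eqLocus hs ht rfl using 1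
  ext i
  simp

end

variable {G : Type u} [Group G] [TopologicalSpace G] [IsTopologicalGroup G] {R : Type w} [Ring R]

/-- Two fixed sections which agree at `K` agree on a basic neighbourhood of `K`. -/
theorem exists_forall_eq (E : EqSheaf G (SubgroupSpace G) R) {N : OpenNormalSubgroup G}
    {y : SubgroupSpace (G ⧸ N.toSubgroup)} {s t : ∀ K : {K // (projMap N).base K = y}, E.stalk K.1}
    (hs : Continuous fun K => (⟨K.1, s K⟩ : Etale E.stalk))
    (ht : Continuous fun K => (⟨K.1, t K⟩ : Etale E.stalk))
    {K : SubgroupSpace G} (hK : (projMap N).base K = y) (h : s ⟨K, hK⟩ = t ⟨K, hK⟩) :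
    ∃ M, M ≤ N ∧ ∀ L (hL : (projMap N).base L = y),
      (projMap M).base L = (projMap M).base K → s ⟨L, hL⟩ = t ⟨L, hL⟩ := by
  obtain ⟨O, hO, hOe⟩ := isOpen_induced_iff.1 (E.isOpen_setOf_eq hs ht)
  have hKO : K ∈ O := (Set.ext_iff.1 hOe ⟨K, hK⟩).2 h
  obtain ⟨M, hM⟩ := SubgroupSpace.exists_basicOpen_subset hO hKO
  refine ⟨M ⊓ N, inf_le_right, fun L hL hLK => (Set.ext_iff.1 hOe ⟨L, hL⟩).1 (hM ?_)⟩
  exact SubgroupSpace.mem_basicOpen_iff.2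
    (SubgroupSpace.projMap_base_eq_of_le inf_le_left hLK)

/-- Every germ of `E` at `K` extends to a section over a basic neighbourhood of `K` which is
equivariant for a small open normal subgroup. -/
theorem exists_fixedSection [CompactSpace G] [TotallyDisconnectedSpace G]
    (E : EqSheaf G (SubgroupSpace G) R) (K : SubgroupSpace G) (a : E.stalk K) :
    ∃ (N : OpenNormalSubgroup G) (s : fixedSections (projMap N) E ((projMap N).base K)),
      s.1 ⟨K, rfl⟩ = a := by
  obtain ⟨U, hU, hKU, hinj⟩ := E.isLocalHomeomorph.exists_injOn ⟨K, a⟩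
  have hact := (hU.preimage E.continuous_act)
  obtain ⟨A, B, hA, hB, hA1, hB1, hAB⟩ := isOpen_prod_iff.1 hact 1 ⟨K, a⟩ (by
    have : (⟨(1 : G) • K, E.act 1 rfl a⟩ : Etale E.stalk) = ⟨K, a⟩ := by
      have key : ∀ {L : SubgroupSpace G} (h : (1 : G) • K = L),
          (⟨(1 : G) • K, E.act 1 rfl a⟩ : Etale E.stalk) = ⟨L, E.act 1 h a⟩ := by
        rintro _ rfl
        rfl
      rw [key (one_smul G K), E.act_one]
    exact (congrArg (· ∈ U) this).mpr hKU)
  -- On U the projection is injective, and elements of A move B into U. Taking values in V therefore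
  -- controls both a section and its translates by A.
  let V := U ∩ B
  have hV : IsOpen V := hU.inter hB
  obtain ⟨N₁, hN₁⟩ := ProfiniteGrp.exist_openNormalSubgroup_sub_open_nhds_of_one hA hA1
  obtain ⟨N₂, hN₂⟩ := SubgroupSpace.exists_basicOpen_subset
    (E.isLocalHomeomorph.isOpenMap V hV) (K := K) ⟨⟨K, a⟩, ⟨hKU, hB1⟩, rfl⟩
  let N := N₁ ⊓ N₂
  have hex : ∀ L : {L // (projMap N).base L = (projMap N).base K},
      ∃ b : E.stalk L.1, (⟨L.1, b⟩ : Etale E.stalk) ∈ V := by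
    rintro ⟨L, hL⟩
    obtain ⟨⟨L', b⟩, hb, h⟩ := hN₂ (SubgroupSpace.mem_basicOpen_iff.2
      (SubgroupSpace.projMap_base_eq_of_le inf_le_right hL))
    obtain rfl : L' = L := h
    exact ⟨b, hb⟩
  choose s hs using hex
  have huniq : ∀ {L : SubgroupSpace G} {b c : E.stalk L}, (⟨L, b⟩ : Etale E.stalk) ∈ U →
      (⟨L, c⟩ : Etale E.stalk) ∈ U → b = c := by
    intro L b c hb hc
    simpa using hinj hb hc rfl
  refine ⟨N, ⟨s, ⟨fun W hW => ?_⟩, ?_⟩, huniq (hs ⟨K, rfl⟩).1 hKU⟩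
  · refine isOpen_induced_iff.2 ⟨_, E.isLocalHomeomorph.isOpenMap _ (hV.inter hW), ?_⟩
    ext L
    constructor
    · rintro ⟨⟨L', b⟩, ⟨hb, hbW⟩, h⟩
      obtain rfl : L' = L.1 := h
      obtain rfl : b = s L := huniq hb.1 (hs L).1
      exact hbW
    · exact fun h => ⟨_, ⟨hs L, h⟩, rfl⟩
  · rintro n hn ⟨L, hL⟩ ⟨L', hL'⟩ h
    dsimp only at h
    subst h
    have hnN : n ∈ N := (QuotientGroup.eq_one_iff n).1 hn
    -- Both n · s(L) and s(nL) lie in U over the same point, hence coincide.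
    refine huniq ?_ (hs ⟨n • L, hL'⟩).1
    exact @hAB (n, ⟨L, s ⟨L, hL⟩⟩) ⟨hN₁ (inf_le_left (a := N₁) (b := N₂) hnN), (hs ⟨L, hL⟩).2⟩

end EqSheaf

section

variable {G : Type u} [Group G] [TopologicalSpace G] [IsTopologicalGroup G] {R : Type w} [Ring R]

/-- The cocone under `N ↦ p̄_N^* (p̄_N)_* E` with vertex `E` given by evaluation of sections. -/
noncomputable def evalCocone (E : EqSheaf G (SubgroupSpace G) R) :
    Limits.Cocone ((pullDiagram G R).obj ((pushDiagram G R).obj E)) where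
  pt := E
  ι :=
    { app := fun N => evalSections (projMap N.unop) (projMap_surjective N.unop) E
      naturality := fun N _ f => hom_ext fun K s =>
        transport_sections_apply (projMap N.unop) (projMap_surjective N.unop) E
          (transMap_projMap (leOfHom f.unop) K) s K _ }

theorem pullDiagram_pushDiagram_map_apply (E : EqSheaf G (SubgroupSpace G) R)
    {N M : (OpenNormalSubgroup G)ᵒᵖ} (f : N ⟶ M) (K : SubgroupSpace G)
    (s : fixedSections (projMap N.unop) E ((projMap N.unop).base K)) (L : SubgroupSpace G)
    (hL : (projMap M.unop).base L = (projMap M.unop).base K) :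
    ((((pullDiagram G R).obj ((pushDiagram G R).obj E)).map f).app K s :
      fixedSections (projMap M.unop) E ((projMap M.unop).base K)).1 ⟨L, hL⟩ =
      s.1 ⟨L, SubgroupSpace.projMap_base_eq_of_le (leOfHom f.unop) hL⟩ :=
  transport_sections_apply (projMap N.unop) (projMap_surjective N.unop) E
    (transMap_projMap (leOfHom f.unop) K) s L _

/-- Evaluation of sections exhibits `E` as the colimit of the sheaves `p̄_N^* (p̄_N)_* E`. -/
theorem isIso_desc_evalCocone [CompactSpace G] [TotallyDisconnectedSpace G]
    (E : EqSheaf G (SubgroupSpace G) R)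
    {c : Limits.Cocone ((pullDiagram G R).obj ((pushDiagram G R).obj E))}
    (hc : Limits.IsColimit c) : IsIso (hc.desc (evalCocone E)) := by
  have hdesc : ∀ (N) (K : SubgroupSpace G)
      (s : fixedSections (projMap N) E ((projMap N).base K)),
      (hc.desc (evalCocone E)).app K ((c.ι.app (Opposite.op N)).app K s) = s.1 ⟨K, rfl⟩ :=
    fun N K s => congrArg (fun t => Hom.app t K s) (hc.fac (evalCocone E) (Opposite.op N))
  refine isIso_of_bijective _ fun K => ⟨?_, fun a => ?_⟩
  · refine (injective_iff_map_eq_zero _).2 fun a ha => ?_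
    obtain ⟨N, s, rfl⟩ := exists_rep_of_isColimit hc a
    have h0 : (s : fixedSections (projMap N.unop) E ((projMap N.unop).base K)).1 ⟨K, rfl⟩ = 0 :=
      (hdesc N.unop K s).symm.trans ha
    -- Vanishing at K spreads to the fibre of p_M through K, so the restriction of s to stage M is
    -- the zero section.
    obtain ⟨M, hMN, hM⟩ := exists_forall_eq E
      (s : fixedSections (projMap N.unop) E ((projMap N.unop).base K)).2.1
      (0 : fixedSections (projMap N.unop) E ((projMap N.unop).base K)).2.1 rfl h0
    refine Eq.trans ?_ (map_zero ((c.ι.app N).app K))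
    refine (ι_app_eq_iff_of_isColimit hc _ _).2 ⟨Opposite.op M, (homOfLE hMN).op,
      (homOfLE hMN).op, ?_⟩
    rw [map_zero]
    refine sections_ext (p := projMap M) fun L hL => ?_
    exact (pullDiagram_pushDiagram_map_apply E (homOfLE hMN).op K s L hL).trans (hM L _ hL)
  · obtain ⟨N, s, rfl⟩ := exists_fixedSection E K a
    exact ⟨_, hdesc N K s⟩

end

/-! ### The unit for diagrams with invertible adjoint structure maps -/

namespace SheafDiagram

variable {G : Type u} [Group G] [TopologicalSpace G] [IsTopologicalGroup G] {R : Type w} [Ring R]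

theorem hom_ext {D D' : SheafDiagram G R} {f g : D ⟶ D'} (h : ∀ N, f.app N = g.app N) : f = g :=
  Hom.ext (funext h)

theorem isIso_of_isIso_app {D D' : SheafDiagram G R} (f : D ⟶ D') [∀ N, IsIso (f.app N)] :
    IsIso f := by
  let g : D' ⟶ D :=
    { app := fun N => inv (f.app N)
      comm := fun {M N} h => by
        rw [Functor.map_inv, IsIso.comp_inv_eq, Category.assoc, IsIso.eq_inv_comp]
        exact (f.comm h).symm }
  exact ⟨g, hom_ext fun N => IsIso.hom_inv_id (f.app N), hom_ext fun N =>
    IsIso.inv_hom_id (f.app N)⟩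

variable (D : SheafDiagram G R)

/-- The map `(D_N)_{p_N K} → (D_M)_{p_M K}` given by the structure map of a diagram. -/
def strAt {M N : OpenNormalSubgroup G} (h : M ≤ N) (K : SubgroupSpace G) :
    (D.sheaf N).stalk ((projMap N).base K) →ₗ[R] (D.sheaf M).stalk ((projMap M).base K) :=
  (pullDiagramMap D h).app K

theorem strAt_apply {M N : OpenNormalSubgroup G} (h : M ≤ N) (K : SubgroupSpace G)
    (a : (D.sheaf N).stalk ((projMap N).base K)) :
    D.strAt h K a = pullbackApp (D.str h) ((projMap M).base K)
      ((D.sheaf N).transport (transMap_projMap h K) a) := rfl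

theorem strAt_trans {L M N : OpenNormalSubgroup G} (h₁ : L ≤ M) (h₂ : M ≤ N) (K : SubgroupSpace G)
    (a : (D.sheaf N).stalk ((projMap N).base K)) :
    D.strAt h₁ K (D.strAt h₂ K a) = D.strAt (h₁.trans h₂) K a :=
  (congrArg (fun t => EqSheaf.Hom.app t K a)
    (((pullDiagram G R).obj D).map_comp (homOfLE h₂).op (homOfLE h₁).op)).symm

/-- Naturality of the structure map under an equality of points. It lets a germ be compared at
different K with the same image in S(G/M). -/
theorem transport_str {M N : OpenNormalSubgroup G} (h : M ≤ N)
    {z z' : SubgroupSpace (G ⧸ M.toSubgroup)} (hz : z = z')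
    {y : SubgroupSpace (G ⧸ N.toSubgroup)} (e : y = (transMap h).base z)
    (e' : y = (transMap h).base z') (a : (D.sheaf N).stalk y) :
    (D.sheaf M).transport hz (pullbackApp (D.str h) z ((D.sheaf N).transport e a)) =
      pullbackApp (D.str h) z' ((D.sheaf N).transport e' a) := by
  subst hz
  simp

theorem transport_strAt {M N : OpenNormalSubgroup G} (h : M ≤ N) {K K' : SubgroupSpace G}
    (hM : (projMap M).base K = (projMap M).base K') (hN : (projMap N).base K = (projMap N).base K')
    (a : (D.sheaf N).stalk ((projMap N).base K)) :
    (D.sheaf M).transport hM (D.strAt h K a) =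
      D.strAt h K' ((D.sheaf N).transport hN a) := by
  rw [strAt_apply, strAt_apply, transport_transport]
  exact D.transport_str h hM _ _ a

variable {D} (c : Limits.Cocone ((pullDiagram G R).obj D))

/-- The maps `(D_N)_{p_N K} → E_K` of a cocone with vertex `E` under `N ↦ p̄_N^* D_N`. -/
def coconeApp (N : OpenNormalSubgroup G) (K : SubgroupSpace G) :
    (D.sheaf N).stalk ((projMap N).base K) →ₗ[R] c.pt.stalk K :=
  (c.ι.app (Opposite.op N)).app K

theorem coconeApp_strAt {M N : OpenNormalSubgroup G} (h : M ≤ N) (K : SubgroupSpace G)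
    (a : (D.sheaf N).stalk ((projMap N).base K)) :
    coconeApp c M K (D.strAt h K a) = coconeApp c N K a :=
  congrArg (fun t => EqSheaf.Hom.app t K a) (c.w (homOfLE h).op)

/-- The adjoint `D_N → (p̄_N)_* E` of a leg `p̄_N^* D_N → E` of a cocone. -/
noncomputable def coconeAdjunct (N : OpenNormalSubgroup G) :
    D.sheaf N ⟶ (pushforward R (projMap N) (projMap_surjective N)).obj c.pt :=
  adjunct (projMap N) (projMap_surjective N) (c.ι.app (Opposite.op N))

/-- The section of the vertex of a cocone defined by a germ of `D_N`. -/
noncomputable def coconeSection (N : OpenNormalSubgroup G)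
    (y : SubgroupSpace (G ⧸ N.toSubgroup)) (a : (D.sheaf N).stalk y) :
    fixedSections (projMap N) c.pt y :=
  (coconeAdjunct c N).app y a

theorem coconeSection_apply (N : OpenNormalSubgroup G) (y : SubgroupSpace (G ⧸ N.toSubgroup))
    (a : (D.sheaf N).stalk y) (K : SubgroupSpace G) (hK : (projMap N).base K = y) :
    (coconeSection c N y a).1 ⟨K, hK⟩ = coconeApp c N K ((D.sheaf N).transport hK.symm a) := rfl

/-- The map of diagrams `D → p̄_• E` defined by a cocone with vertex `E` under `N ↦ p̄_N^* D_N`. -/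
noncomputable def toPushDiagram : D ⟶ (pushDiagram G R).obj c.pt where
  app N := coconeAdjunct c N
  comm {M N} h := by
    ext y a
    refine sections_ext (p := projMap M) ?_
    intro K hK
    have key : ∀ b : (D.sheaf N).stalk ((transMap h).base y),
        (D.sheaf M).transport hK.symm (pullbackApp (D.str h) y b) =
          D.strAt h K ((D.sheaf N).transport
            ((transMap_projMap h K).trans (by rw [hK])).symm b) := fun b => by
      rw [strAt_apply, transport_transport, ← D.transport_str h hK.symm rfl, transport_rfl]
    exact (congrArg (coconeApp c M K) (key a)).trans (coconeApp_strAt c h K _)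

theorem adjStr_apply {M N : OpenNormalSubgroup G} (h : M ≤ N)
    (y : SubgroupSpace (G ⧸ N.toSubgroup)) (a : (D.sheaf N).stalk y)
    (z : SubgroupSpace (G ⧸ M.toSubgroup)) (hz : (transMap h).base z = y) :
    ((D.adjStr h).app y a : fixedSections (transMap h) (D.sheaf M) y).1 ⟨z, hz⟩ =
      pullbackApp (D.str h) z ((D.sheaf N).transport hz.symm a) := rfl

variable [CompactSpace G] {c}

/-- If a defines the zero section, then at each K it dies at some stage; by compactness one stage M
serves the whole fibre. Then the adjoint structure map to stage M kills a, and that map is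
injective. -/
theorem coconeSection_injective (hc : Limits.IsColimit c)
    (hD : ∀ (M N : OpenNormalSubgroup G) (h : M ≤ N), IsIso (D.adjStr h))
    (N : OpenNormalSubgroup G) (y : SubgroupSpace (G ⧸ N.toSubgroup)) :
    Function.Injective (coconeSection c N y) := by
  refine (injective_iff_map_eq_zero ((coconeAdjunct c N).app y)).2 fun a ha => ?_
  have ha' : ∀ K (hK : (projMap N).base K = y),
      coconeApp c N K ((D.sheaf N).transport hK.symm a) = 0 := fun K hK =>
    congrArg (fun t : fixedSections (projMap N) c.pt y => t.1 ⟨K, hK⟩) ha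
  -- Quantifying over all K above z makes this a condition on the point z of S(G/M), in the form
  -- `exists_uniform` requires.
  let P : ∀ M : OpenNormalSubgroup G, SubgroupSpace (G ⧸ M.toSubgroup) → Prop := fun M z =>
    ∃ h : M ≤ N, ∀ K (_ : (projMap M).base K = z) (hy : (projMap N).base K = y),
      D.strAt h K ((D.sheaf N).transport hy.symm a) = 0
  obtain ⟨M, hMN, hM⟩ : ∃ M, M ≤ N ∧ ∀ K, (projMap N).base K = y → P M ((projMap M).base K) := by
    refine SubgroupSpace.exists_uniform y P ?_ ?_
    · rintro L M hLM K ⟨h, h0⟩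
      refine ⟨hLM.trans h, fun K' hK' hy => ?_⟩
      rw [← strAt_trans D hLM h, h0 K' (SubgroupSpace.projMap_base_eq_of_le hLM hK') hy, map_zero]
    · intro K hK
      obtain ⟨k, f, g, hfg⟩ := (ι_app_eq_iff_of_isColimit hc
        ((D.sheaf N).transport hK.symm a : (D.sheaf N).stalk ((projMap N).base K))
        (0 : (D.sheaf N).stalk ((projMap N).base K))).1 ((ha' K hK).trans (map_zero _).symm)
      have h : k.unop ≤ N := leOfHom f.unop
      refine ⟨k.unop, h, fun K' hK' hy => ?_⟩
      have h1 : D.strAt h K ((D.sheaf N).transport hK.symm a) = 0 :=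
        hfg.trans (map_zero ((((pullDiagram G R).obj D).map g).app K))
      have h2 := D.transport_strAt h hK'.symm (hK.trans hy.symm) ((D.sheaf N).transport hK.symm a)
      rw [h1, map_zero, transport_transport] at h2
      exact h2.symm
  have := hD M N hMN
  refine (injective_iff_map_eq_zero ((D.adjStr hMN).app y)).1
    (bijective_of_isIso (D.adjStr hMN) y).injective a ?_
  refine sections_ext (p := transMap hMN) fun z hz => (adjStr_apply hMN y a z hz).trans ?_
  obtain ⟨K, rfl⟩ := SubgroupSpace.projMap_base_surjective M z
  obtain ⟨h, h0⟩ := hM K ((transMap_projMap hMN K).trans hz)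
  have h1 := h0 K rfl ((transMap_projMap hMN K).trans hz)
  rwa [strAt_apply, transport_transport] at h1

/-- Near each K the section s is defined by a germ of some D_M, and compactness makes M uniform over
the fibre. By injectivity at stage M these germs are unique, so they inherit equivariance from s and
form a fixed section of D_M. Surjectivity of the adjoint structure map then yields a germ of D_N. -/
theorem coconeSection_surjective (hc : Limits.IsColimit c)
    (hD : ∀ (M N : OpenNormalSubgroup G) (h : M ≤ N), IsIso (D.adjStr h))
    (N : OpenNormalSubgroup G) (y : SubgroupSpace (G ⧸ N.toSubgroup)) :
    Function.Surjective (coconeSection c N y) := by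
  intro s
  -- Moving a germ to a smaller L only restricts the section it defines to a fibre of p_L.
  have hstep : ∀ {L M : OpenNormalSubgroup G} (h : L ≤ M) {K K' : SubgroupSpace G}
      (hK : (projMap L).base K' = (projMap L).base K)
      (b : (D.sheaf M).stalk ((projMap M).base K)),
      coconeApp c L K' ((D.sheaf L).transport hK.symm (D.strAt h K b)) =
        coconeApp c M K' ((D.sheaf M).transport
          (SubgroupSpace.projMap_base_eq_of_le h hK.symm) b) := by
    intro L M h K K' hK b
    rw [transport_strAt D h hK.symm (SubgroupSpace.projMap_base_eq_of_le h hK.symm),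
      coconeApp_strAt]
  let P : ∀ M : OpenNormalSubgroup G, SubgroupSpace (G ⧸ M.toSubgroup) → Prop := fun M z =>
    ∃ b : (D.sheaf M).stalk z, ∀ K (hK : (projMap M).base K = z) (hy : (projMap N).base K = y),
      coconeApp c M K ((D.sheaf M).transport hK.symm b) = s.1 ⟨K, hy⟩
  obtain ⟨M, hMN, hM⟩ : ∃ M, M ≤ N ∧ ∀ K, (projMap N).base K = y → P M ((projMap M).base K) := by
    refine SubgroupSpace.exists_uniform y P ?_ ?_
    · rintro L M hLM K ⟨b, hb⟩
      refine ⟨D.strAt hLM K b, fun K' hK' hy => ?_⟩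
      rw [hstep hLM hK']
      exact hb K' (SubgroupSpace.projMap_base_eq_of_le hLM hK') hy
    · rintro K rfl
      obtain ⟨j, b, hb⟩ := exists_rep_of_isColimit hc (s.1 ⟨K, rfl⟩)
      -- Below N, the fibre through K lies in the domain of s, so the section of the representing
      -- germ can be compared with s.
      have hle : j.unop ⊓ N ≤ N := inf_le_right
      let b₀ : (D.sheaf (j.unop ⊓ N)).stalk ((projMap (j.unop ⊓ N)).base K) :=
        D.strAt inf_le_left K b
      have hb₀ : coconeApp c (j.unop ⊓ N) K b₀ = s.1 ⟨K, rfl⟩ :=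
        (coconeApp_strAt c inf_le_left K b).trans hb
      obtain ⟨M, hMN, hM⟩ := exists_forall_eq c.pt
        (coconeSection c (j.unop ⊓ N) _ b₀).2.1
        (s.2.1.comp (Continuous.subtype_mk continuous_subtype_val
          fun L : {L // (projMap (j.unop ⊓ N)).base L = (projMap (j.unop ⊓ N)).base K} =>
            SubgroupSpace.projMap_base_eq_of_le hle L.2)) (K := K) rfl
        (by rw [coconeSection_apply, transport_rfl]; exact hb₀)
      refine ⟨M, D.strAt hMN K b₀, fun K' hK' hy => ?_⟩
      rw [hstep hMN hK']
      exact hM K' (SubgroupSpace.projMap_base_eq_of_le hMN hK') hK'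
  have hM' : ∀ z : {z // (transMap hMN).base z = y}, ∃ b : (D.sheaf M).stalk z.1,
      ∀ K (hK : (projMap M).base K = z.1) (hy : (projMap N).base K = y),
        coconeApp c M K ((D.sheaf M).transport hK.symm b) = s.1 ⟨K, hy⟩ := by
    rintro ⟨z, hz⟩
    obtain ⟨K, rfl⟩ := SubgroupSpace.projMap_base_surjective M z
    exact hM K ((transMap_projMap hMN K).trans hz)
  choose b hb using hM'
  have hb' : b ∈ fixedSections (transMap hMN) (D.sheaf M) y := by
    refine ⟨continuous_of_discreteTopology, ?_⟩
    rintro n hn ⟨z, hz⟩ ⟨z', hz'⟩ h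
    dsimp only at h
    -- Injectivity at stage M reduces equivariance of b to that of the sections its values define,
    -- that is, of s.
    refine coconeSection_injective hc hD M z' (sections_ext ?_)
    intro K hK
    have hKy : (projMap N).base K = y :=
      (transMap_projMap hMN K).trans ((congrArg _ hK).trans hz')
    rw [coconeSection_apply, coconeSection_apply, hb ⟨z', hz'⟩ K hK hKy,
      ← (D.sheaf M).act_transport n rfl hK.symm h (h.trans hK.symm), transport_rfl]
    -- A lift g of n ∈ N/M lies in N, hence s is g-equivariant.
    obtain ⟨g, rfl⟩ := projMap_surjective M n
    have hg : (projMap N).hom g = 1 := hn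
    obtain rfl : (projMap M).base (g⁻¹ • K) = z := base_inv_smul (projMap M) g h hK
    have hK'y : (projMap N).base (g⁻¹ • K) = y := (transMap_projMap hMN _).trans hz
    have h1 := hb ⟨_, hz⟩ (g⁻¹ • K) rfl hK'y
    rw [transport_rfl] at h1
    refine (pullbackApp_act (c.ι.app (Opposite.op M)) g (smul_inv_smul g K)
      (h.trans hK.symm) _).symm.trans ?_
    refine (congrArg (c.pt.act g (smul_inv_smul g K)) h1).trans ?_
    exact fixedSections_act s hg hK'y hKy (smul_inv_smul g K)
  have := hD M N hMN
  obtain ⟨a, ha⟩ := (bijective_of_isIso (D.adjStr hMN) y).surjective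
    (⟨b, hb'⟩ : fixedSections (transMap hMN) (D.sheaf M) y)
  refine ⟨a, sections_ext fun K hK => ?_⟩
  have hz : (transMap hMN).base ((projMap M).base K) = y :=
    (transMap_projMap hMN K).symm.trans hK
  have h1 : pullbackApp (D.str hMN) ((projMap M).base K) ((D.sheaf N).transport hz.symm a) =
      b ⟨_, hz⟩ :=
    congrArg (fun t : fixedSections (transMap hMN) (D.sheaf M) y => t.1 ⟨_, hz⟩) ha
  rw [coconeSection_apply, ← coconeApp_strAt c hMN, strAt_apply, transport_transport, h1,
    ← hb ⟨_, hz⟩ K rfl hK, transport_rfl]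

/-- If the adjoint structure maps of `D` are isomorphisms, then so is the unit
`D → p̄_• colim_N p̄_N^* D_N`. -/
theorem isIso_toPushDiagram (hc : Limits.IsColimit c)
    (hD : ∀ (M N : OpenNormalSubgroup G) (h : M ≤ N), IsIso (D.adjStr h)) :
    IsIso (toPushDiagram c) := by
  have : ∀ N, IsIso ((toPushDiagram c).app N) := fun N => isIso_of_bijective _ fun y =>
    ⟨coconeSection_injective hc hD N y, coconeSection_surjective hc hD N y⟩
  exact isIso_of_isIso_app _

end SheafDiagram

/-! ### The Weyl condition and the equivalence -/

section

variable {G : Type u} [Group G] [TopologicalSpace G] [IsTopologicalGroup G] {R : Type w} [Ring R]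

/-- Translation of a section does not depend on the lift of k to G. At each K over y the lift can be
taken in K, where it fixes the stalk. -/
theorem isWeyl_pushforward {E : EqSheaf G (SubgroupSpace G) R} (hE : isWeyl G R E)
    (N : OpenNormalSubgroup G) :
    isWeyl (G ⧸ N.toSubgroup) R ((pushforward R (projMap N) (projMap_surjective N)).obj E) := by
  intro y k hk s
  refine sections_ext (p := projMap N) fun K hK => ?_
  have hk' : k ∈ ((projMap N).base K).toSubgroup := hK ▸ hk
  obtain ⟨l, hl, rfl⟩ := hk'
  refine (translate_apply (projMap N) E (k := l) (Function.surjInv_eq _ _).symm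
    (by rw [Function.surjInv_eq (projMap_surjective N)]; exact SubgroupSpace.smul_eq_self hk) s hK hK
    (SubgroupSpace.smul_eq_self hl)).trans ?_
  exact hE K l hl _

/-- The fibre of p_N over y is the disjoint union of the open fibres of p_M over the z above y. An
N-equivariant section over it is thus a family of M-equivariant sections which N/M permutes
compatibly. -/
theorem isIso_adjStr_pushDiagram (E : EqSheaf G (SubgroupSpace G) R) {M N : OpenNormalSubgroup G}
    (h : M ≤ N) : IsIso (((pushDiagram G R).obj E).adjStr h) := by
  let P := (pushforward R (projMap M) (projMap_surjective M)).obj E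
  have hadj : ∀ (y : SubgroupSpace (G ⧸ N.toSubgroup)) (s : fixedSections (projMap N) E y)
      (z : SubgroupSpace (G ⧸ M.toSubgroup)) (hz : (transMap h).base z = y) (K : SubgroupSpace G)
      (hK : (projMap M).base K = z),
      (((((pushDiagram G R).obj E).adjStr h).app y s : fixedSections (transMap h) P y).1 ⟨z, hz⟩ :
        fixedSections (projMap M) E z).1 ⟨K, hK⟩ =
        s.1 ⟨K, (transMap_projMap h K).trans ((congrArg _ hK).trans hz)⟩ :=
    fun y s z hz K hK => transport_sections_apply (projMap N) (projMap_surjective N) E hz.symm s K _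
  refine isIso_of_bijective _ fun y => ⟨fun s s' hss => ?_, fun t => ?_⟩
  · refine sections_ext (p := projMap N) fun K hK => ?_
    have hz : (transMap h).base ((projMap M).base K) = y := (transMap_projMap h K).symm.trans hK
    refine (hadj y s _ hz K rfl).symm.trans (Eq.trans ?_ (hadj y s' _ hz K rfl))
    exact congrArg (fun t : fixedSections (transMap h) P y =>
      (t.1 ⟨_, hz⟩ : fixedSections (projMap M) E _).1 ⟨K, rfl⟩) hss
  · let t' : ∀ z : {z // (transMap h).base z = y}, fixedSections (projMap M) E z.1 :=
      (t : fixedSections (transMap h) P y).1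
    have ht' : ∀ (z z' : {z // (transMap h).base z = y}) (n : G) (_ : (projMap N).hom n = 1)
        (hn : (projMap M).hom n • z.1 = z'.1), P.act ((projMap M).hom n) hn (t' z) = t' z' :=
      fun z z' n h1 hn => (t : fixedSections (transMap h) P y).2.2 _ h1 z z' hn
    have hz : ∀ K : {K // (projMap N).base K = y},
        (transMap h).base ((projMap M).base K.1) = y := fun K =>
      (transMap_projMap h K.1).symm.trans K.2
    have hcong : ∀ (z : {z // (transMap h).base z = y}) (K : SubgroupSpace G)
        (hK : (projMap M).base K = z.1),
        (t' z).1 ⟨K, hK⟩ = (t' ⟨_, (congrArg _ hK).trans z.2⟩).1 ⟨K, rfl⟩ := by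
      rintro ⟨z, hz⟩ K hK
      dsimp only at hK
      subst hK
      rfl
    -- The glued section takes at K the value of the member of the family indexed by p_M K.
    let s : ∀ K : {K // (projMap N).base K = y}, E.stalk K.1 := fun K =>
      (t' ⟨_, hz K⟩).1 ⟨K.1, rfl⟩
    have hs : s ∈ fixedSections (projMap N) E y := by
      constructor
      -- On the open fibre of p_M through K the glued section is a single member of the family,
      -- hence continuous there.
      · refine ⟨fun W hW => isOpen_iff_forall_mem_open.2 fun K hK => ?_⟩
        obtain ⟨O, hO, hOW⟩ := isOpen_induced_iff.1 (hW.preimage (t' ⟨_, hz K⟩).2.1)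
        refine ⟨Subtype.val ⁻¹' (O ∩ {L | (projMap M).base L = (projMap M).base K.1}), ?_,
          (hO.inter (SubgroupSpace.isOpen_fibre M _)).preimage continuous_subtype_val,
          (Set.ext_iff.1 hOW ⟨K.1, rfl⟩).2 hK, rfl⟩
        rintro L ⟨hLO, hL⟩
        have h1 := (Set.ext_iff.1 hOW ⟨L.1, hL⟩).1 hLO
        exact (congrArg (fun a => (⟨L.1, a⟩ : Etale E.stalk) ∈ W)
          (hcong ⟨_, hz K⟩ L.1 hL)).mp h1
      · intro n hn K K' hK
        have hM : (projMap M).hom n • (projMap M).base K.1 = (projMap M).base K'.1 := by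
          rw [← (projMap M).base_smul, hK]
        have h1 := ht' ⟨_, hz K⟩ ⟨_, hz K'⟩ n hn hM
        refine Eq.trans ?_ (congrArg
          (fun a : fixedSections (projMap M) E ((projMap M).base K'.1) => a.1 ⟨K'.1, rfl⟩) h1)
        exact (translate_apply (projMap M) E (k := n) (Function.surjInv_eq _ _).symm
          (by rw [Function.surjInv_eq (projMap_surjective M), hM]) (t' ⟨_, hz K⟩) rfl rfl hK).symm
    refine ⟨(⟨s, hs⟩ : fixedSections (projMap N) E y), ?_⟩
    refine sections_ext (p := transMap h) fun z hz' => ?_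
    refine sections_ext (p := projMap M) fun K hK => ?_
    exact (hadj y ⟨s, hs⟩ z hz' K hK).trans (hcong ⟨z, hz'⟩ K hK).symm

theorem isCompatibleWeyl_pushDiagram {E : EqSheaf G (SubgroupSpace G) R} (hE : isWeyl G R E) :
    isCompatibleWeyl G R ((pushDiagram G R).obj E) :=
  ⟨isWeyl_pushforward hE, fun _ _ h => isIso_adjStr_pushDiagram E h⟩

/-- A germ at K comes from some D_N, on which k ∈ K acts through its image in KN/N, hence trivially.
-/
theorem isWeyl_of_isColimit {D : SheafDiagram G R}
    (hD : ∀ N, isWeyl (G ⧸ N.toSubgroup) R (D.sheaf N))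
    {c : Limits.Cocone ((pullDiagram G R).obj D)} (hc : Limits.IsColimit c) :
    isWeyl G R c.pt := by
  intro K k hk a
  obtain ⟨N, b, rfl⟩ := exists_rep_of_isColimit hc a
  have hk' : (projMap N.unop).hom k ∈ ((projMap N.unop).base K).toSubgroup := ⟨k, hk, rfl⟩
  refine (pullbackApp_act (c.ι.app N) k (SubgroupSpace.smul_eq_self hk)
    (SubgroupSpace.smul_eq_self hk') b).trans ?_
  exact congrArg (pullbackApp (c.ι.app N) K) (hD N.unop _ _ hk' b)

instance : Limits.HasColimitsOfShape (OpenNormalSubgroup G)ᵒᵖ (EqSheaf G (SubgroupSpace G) R) :=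
  hasColimitsOfShape_of_isFiltered

theorem toPushDiagram_naturality {D D' : SheafDiagram G R} (f : D ⟶ D') :
    f ≫ SheafDiagram.toPushDiagram (Limits.colimit.cocone ((pullDiagram G R).obj D')) =
      SheafDiagram.toPushDiagram (Limits.colimit.cocone ((pullDiagram G R).obj D)) ≫
        (pushDiagram G R).map (Limits.colim.map ((pullDiagram G R).map f)) := by
  refine SheafDiagram.hom_ext fun N => EqSheaf.hom_ext fun y a => ?_
  refine sections_ext (p := projMap N) fun K hK => ?_
  have h1 := congrArg (fun t => EqSheaf.Hom.app t K ((D.sheaf N).transport hK.symm a))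
    (Limits.ι_colimMap ((pullDiagram G R).map f) (Opposite.op N))
  refine Eq.trans ?_ h1.symm
  exact congrArg
    (SheafDiagram.coconeApp (Limits.colimit.cocone ((pullDiagram G R).obj D')) N K)
    (app_transport (f.app N) hK.symm a).symm

theorem desc_evalCocone_naturality {E E' : EqSheaf G (SubgroupSpace G) R} (f : E ⟶ E') :
    Limits.colim.map ((pullDiagram G R).map ((pushDiagram G R).map f)) ≫
        (Limits.colimit.isColimit _).desc (evalCocone E') =
      (Limits.colimit.isColimit _).desc (evalCocone E) ≫ f := by
  refine Limits.colimit.hom_ext fun N => ?_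
  have h1 := (Limits.colimit.isColimit _).fac (evalCocone E) N
  have h2 := (Limits.colimit.isColimit _).fac (evalCocone E') N
  refine ((Category.assoc _ _ _).symm.trans ?_).trans (Category.assoc _ _ _)
  refine (congrArg (· ≫ _) (Limits.ι_colimMap _ N)).trans ?_
  refine ((Category.assoc _ _ _).trans (congrArg (_ ≫ ·) h2)).trans ?_
  exact (congrArg (· ≫ f) h1).symm

variable (G R)

/-- The functor `D ↦ colim_N p̄_N^* D_N` from compatible diagrams of Weyl sheaves. -/
noncomputable def colimWeyl : CompatibleWeylDiagram G R ⥤ WeylSheaf G R :=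
  (isWeyl G R).lift ((isCompatibleWeyl G R).ι ⋙ pullDiagram G R ⋙ Limits.colim) fun D =>
    isWeyl_of_isColimit D.property.1 (Limits.colimit.isColimit _)

/-- The functor `E ↦ p̄_• E` from Weyl sheaves. -/
noncomputable def pushWeyl : WeylSheaf G R ⥤ CompatibleWeylDiagram G R :=
  (isCompatibleWeyl G R).lift ((isWeyl G R).ι ⋙ pushDiagram G R) fun E =>
    isCompatibleWeyl_pushDiagram E.property

variable [CompactSpace G]

/-- The unit `D ≅ p̄_• colim_N p̄_N^* D_N`. -/
noncomputable def weylUnitIso : 𝟭 (CompatibleWeylDiagram G R) ≅ colimWeyl G R ⋙ pushWeyl G R :=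
  NatIso.ofComponents (fun D => (isCompatibleWeyl G R).isoMk
    (@asIso _ _ _ _ (SheafDiagram.toPushDiagram (Limits.colimit.cocone _))
      (SheafDiagram.isIso_toPushDiagram (Limits.colimit.isColimit _) D.property.2)))
    fun f => ObjectProperty.hom_ext _ (toPushDiagram_naturality f.hom)

/-- The counit `colim_N p̄_N^* (p̄_N)_* E ≅ E`. -/
noncomputable def weylCounitIso [TotallyDisconnectedSpace G] :
    pushWeyl G R ⋙ colimWeyl G R ≅ 𝟭 (WeylSheaf G R) :=
  NatIso.ofComponents (fun E => (isWeyl G R).isoMk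
    (@asIso _ _ _ _ ((Limits.colimit.isColimit _).desc (evalCocone E.obj))
      (isIso_desc_evalCocone E.obj (Limits.colimit.isColimit _))))
    fun f => ObjectProperty.hom_ext _ (desc_evalCocone_naturality f.hom)

/-- Compatible diagrams of Weyl sheaves over the `S (G/N)` are equivalent to Weyl sheaves over
`S G`. -/
noncomputable def weylEquivalence [TotallyDisconnectedSpace G] :
    CompatibleWeylDiagram G R ≌ WeylSheaf G R :=
  -- `Equivalence.mk` corrects the unit so that the triangle identity holds; the two natural
  -- isomorphisms are enough.
  CategoryTheory.Equivalence.mk (colimWeyl G R) (pushWeyl G R) (weylUnitIso G R)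
    (weylCounitIso G R)

end

theorem corollary11p7 (G : Type u) [Group G] [TopologicalSpace G] [IsTopologicalGroup G]
    [CompactSpace G] [T2Space G] [TotallyDisconnectedSpace G] :
    ∃ (_ : Limits.HasColimitsOfShape (OpenNormalSubgroup G)ᵒᵖ (EqSheaf G (SubgroupSpace G) ℚ))
      (e : CompatibleWeylDiagram G ℚ ≌ WeylSheaf G ℚ),
      Nonempty (e.functor ⋙ (isWeyl G ℚ).ι ≅
        (isCompatibleWeyl G ℚ).ι ⋙ pullDiagram G ℚ ⋙ Limits.colim) ∧
      Nonempty (e.inverse ⋙ (isCompatibleWeyl G ℚ).ι ≅ (isWeyl G ℚ).ι ⋙ pushDiagram G ℚ) :=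
  -- Both functors are lifts of the stated composites to full subcategories, so composing with the
  -- inclusions returns them definitionally.
  ⟨inferInstance, weylEquivalence G ℚ, ⟨Iso.refl _⟩, ⟨Iso.refl _⟩⟩
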